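/- Let $Q=\{Q(t)\}_{t\ge 0}$ be the Erlang-A ($M(t)/M/c+M$) queue with $c\ge 1$ servers, continuous arrival rate $\lambda(t)\ge 0$, service rate $\mu>0$ and abandonment rate $\theta\ge 0$: the Markov jump process on $\{0,1,2,\dots\}$ that jumps at time $t$ from $n$ to $n+1$ at rate $\lambda(t)$ and from $n$ to $n-1$ at rate $\mu\,(n\wedge c)+\theta\,(n-c)^+$. Let $I\subseteq\mathbb{R}$ be an interval containing $0$ (for example $I=\mathbb{R}$) with $E[e^{\alpha Q(0)}]<\infty$ for $\alpha\in I$, and let the fluid moment generating function $M_f$ be a classical solution, for $t\in[0,T]$ and $\alpha\in I$, of the closure equation $$\frac{\partial M_f}{\partial t}=\lambda(t)(e^{\alpha}-1)M_f+\theta(e^{-\alpha}-1)\frac{\partial M_f}{\partial\alpha}-(\theta-\mu)(e^{-\alpha}-1)\Big(\frac{\partial M_f}{\partial\alpha}\wedge c\,M_f\Big),$$ that is, of the equation for $E[e^{\alpha Q(t)}]$ in which $E[(Q\wedge c)e^{\alpha Q}]$ is replaced by $\partial_\alpha M_f\wedge cM_f$, with the same initial value as the queue, $M_f(0,\alpha)=E[e^{\alpha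 Q(0)}]$ for $\alpha\in I$. (Classical: $M_f$ is continuous on $[0,T]\times I$, and for $0<t<T$ both partial derivatives exist, one-sided in $\alpha$ at an endpoint of $I$, and satisfy the equation.) Then for all $t\in[0,T]$ and $\alpha\in I$ the expectation $E[e^{\alpha Q(t)}]$ is finite, and 1. if $\theta<\mu$, then $E[e^{\alpha Q(t)}]\ge M_f(t,\alpha)$ when $\alpha\ge 0$, and $E[e^{\alpha Q(t)}]\le M_f(t,\alpha)$ when $\alpha\le 0$; 2. if $\theta>\mu$, then $E[e^{\alpha Q(t)}]\le M_f(t,\alpha)$ when $\alpha\ge 0$, and $E[e^{\alpha Q(t)}]\ge M_f(t,\alpha)$ when $\alpha\le 0$; 3. if $\theta=\mu$, then $E[e^{\alpha Q(t)}]=M_f(t,\alpha)$. -/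

import Mathlib

open MeasureTheory ProbabilityTheory Set Filter Topology
open scoped NNReal

noncomputable section

/-- Total departure rate of the Erlang-A queue in state `n`: service at rate `μ` by each of the
`min n c` busy servers, abandonment at rate `θ` by each of the `(n - c)⁺` waiting customers. -/
def erlangADeparture (μ θ : ℝ) (c n : ℕ) : ℝ :=
  μ * min (n : ℝ) (c : ℝ) + θ * max ((n : ℝ) - c) 0

/-- Generator of the Erlang-A (`M(t)/M/c+M`) birth-death process, when the current arrival rate
is `r`. In state `0` the departure rate vanishes, so that the value of `n - 1` is irrelevant. -/
def erlangAGenerator (r μ θ : ℝ) (c : ℕ) (f : ℕ → ℝ) (n : ℕ) : ℝ :=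
  r * (f (n + 1) - f n) + erlangADeparture μ θ c n * (f (n - 1) - f n)

/-- The process `Q` is an Erlang-A queue with arrival rate `lam`, service rate `μ`, abandonment
rate `θ` and `c` servers, with respect to the filtration `ℱ`: it is adapted, has right-continuous
paths with left limits in the discrete space `ℕ`, and is the Markov jump process whose only
transitions are `n ↦ n + 1` at rate `lam t` and `n ↦ n - 1` at rate
`μ * (n ∧ c) + θ * (n - c)⁺`, in the sense of the martingale problem for its generator, with
finitely supported test functions. The initial law is arbitrary. -/
structure IsErlangA {Ω : Type*} [mΩ : MeasurableSpace Ω] (P : Measure Ω)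
    (ℱ : Filtration ℝ≥0 mΩ)
    (lam : ℝ → ℝ) (μ θ : ℝ) (c : ℕ) (Q : ℝ≥0 → Ω → ℕ) : Prop where
  adapted : ∀ t, Measurable[ℱ t] (Q t)
  right_continuous : ∀ ω t, ContinuousWithinAt (fun s => Q s ω) (Ici t) t
  left_limits : ∀ ω t, ∃ n : ℕ, Tendsto (fun s => Q s ω) (𝓝[<] t) (𝓝 n)
  martingale : ∀ f : ℕ → ℝ, f.support.Finite →
    Martingale (fun (t : ℝ≥0) ω => f (Q t ω) -
      ∫ s in (0 : ℝ)..t, erlangAGenerator (lam s) μ θ c f (Q s.toNNReal ω)) ℱ P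

/-- Right-hand side of the closure equation, at arrival rate `r`, for the value `m` of the fluid
moment generating function and the value `p` of its derivative in `α`. -/
def fluidRHS (r μ θ : ℝ) (c : ℕ) (α m p : ℝ) : ℝ :=
  r * (Real.exp α - 1) * m + θ * (Real.exp (-α) - 1) * p
    - (θ - μ) * (Real.exp (-α) - 1) * min p (c * m)

/-- The function `M t α` is a classical solution, for times in `[0, T]` and `α ∈ I`, of the
closure equation `∂ₜ M = fluidRHS (lam t) μ θ c α M (∂_α M)`: it is continuous, and at all times in
`(0, T)` both partial derivatives exist (the one in `α` relative to `I`) and satisfy the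
equation. -/
structure IsFluidMGF (lam : ℝ → ℝ) (μ θ : ℝ) (c : ℕ) (T : ℝ) (I : Set ℝ)
    (M : ℝ → ℝ → ℝ) : Prop where
  continuousOn : ContinuousOn (fun x : ℝ × ℝ => M x.1 x.2) (Icc 0 T ×ˢ I)
  pde : ∀ t ∈ Ioo 0 T, ∀ α ∈ I, ∃ p : ℝ,
    HasDerivWithinAt (fun β => M t β) p I α ∧
    HasDerivAt (fun s => M s α) (fluidRHS (lam t) μ θ c α (M t α) p) t

end

/-! The transform M(t,α) = E[e^{αQ(t)}] satisfies the closure equation, except that κ =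
E[(Q∧c)e^{αQ}] stands where the closure has ∂_αM ∧ cM. The expectation of a minimum is at most the
minimum of the expectations, so κ ≤ ∂_αM ∧ cM. Hence M is a supersolution of the closure equation
where (θ-μ)α ≤ 0 and a subsolution where (θ-μ)α ≥ 0.

The order then follows from a maximum principle on [0,T] × [0,a], or [a,0] if a < 0. Both functions
agree at time 0 and at α = 0, and no boundary values are needed at α = a: on either branch of the
minimum the coefficient of ∂_α is θ or μ times e^{-α} - 1, whose sign is opposite to that of α, so
characteristics run away from 0 and leave at a. This is `nonpos_of_outflow`, with its differential
inequality supplied by `fluidRHS_sub_le` and `sub_fluidRHS_le`.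

The equation for M must be extracted from a martingale problem with finitely supported test
functions. Truncation and Grönwall propagate exponential moments (`exists_exp_moment_bound`), and
dominated convergence extends Dynkin's formula to functions of exponential growth
(`dynkin_of_exp_growth`). The linear departure rate costs a little of the exponent, so with
E[e^{bQ(0)}] finite the equation is obtained only for α < b; `mgf_comparison_of_mem` recovers the
endpoint by continuity. -/

section ErlangA

/-! ### Measurability, and Dynkin's formula for finitely supported functions -/

variable {Ω : Type*} [mΩ : MeasurableSpace Ω]

/-- A process with values in `ℕ` and right-continuous paths is jointly measurable. -/
lemma measurable_uncurry_of_rightContinuous {Q : ℝ≥0 → Ω → ℕ} (hm : ∀ t, Measurable (Q t))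
    (hrc : ∀ ω t, ContinuousWithinAt (fun s => Q s ω) (Ici t) t) :
    Measurable (fun x : ℝ≥0 × Ω => Q x.1 x.2) := by
  obtain ⟨a, N, hN, hlim⟩ : ∃ (a : ℕ → ℕ → ℝ≥0) (N : ℕ → ℝ≥0 → ℕ), (∀ k, Measurable (N k)) ∧
      ∀ t, Tendsto (fun k => a k (N k t)) atTop (𝓝[Ici t] t) := by
    -- Round t up to a grid of mesh 1/(k+1); the `+ 1` in the numerator keeps the grid point to the
    -- right of t, where the paths are continuous.
    refine ⟨fun k n => ((n : ℝ≥0) + 1) / ((k : ℝ≥0) + 1), fun k t => ⌊t * ((k : ℝ≥0) + 1)⌋₊,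
      fun k => Nat.measurable_floor.comp (measurable_id.mul_const _), fun t => ?_⟩
    refine tendsto_nhdsWithin_iff.2 ⟨?_, Eventually.of_forall fun k => ?_⟩
    · have h2 : Tendsto (fun k : ℕ => t + 1 / ((k : ℝ≥0) + 1)) atTop (𝓝 t) := by
        have h3 : Tendsto (fun k : ℕ => 1 / ((k : ℝ≥0) + 1)) atTop (𝓝 0) := by
          rw [← NNReal.tendsto_coe]
          simpa using tendsto_one_div_add_atTop_nhds_zero_nat (𝕜 := ℝ)
        simpa using h3.const_add t
      refine tendsto_of_tendsto_of_tendsto_of_le_of_le tendsto_const_nhds h2 (fun k => ?_)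
        (fun k => ?_)
      · rw [le_div_iff₀ (by positivity)]
        exact (Nat.lt_floor_add_one _).le
      · show _ / _ ≤ _
        rw [add_div]
        gcongr
        rw [div_le_iff₀ (by positivity)]
        exact Nat.floor_le (by positivity)
    · rw [mem_Ici, le_div_iff₀ (by positivity)]
      exact (Nat.lt_floor_add_one _).le
  refine measurable_of_tendsto_metrizable (f := fun (k : ℕ) (x : ℝ≥0 × Ω) =>
    Q (a k (N k x.1)) x.2) (fun k => ?_) ?_
  · have h1 : Measurable (fun y : ℕ × Ω => Q (a k y.1) y.2) :=
      measurable_from_prod_countable_right fun n => hm (a k n)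
    exact h1.comp (((hN k).comp measurable_fst).prodMk measurable_snd)
  · rw [tendsto_pi_nhds]
    intro x
    exact (hrc x.2 x.1).tendsto.comp (hlim x.1)

lemma erlangADeparture_nonneg {μ θ : ℝ} (hμ : 0 < μ) (hθ : 0 ≤ θ) (c n : ℕ) :
    0 ≤ erlangADeparture μ θ c n := by
  unfold erlangADeparture; positivity

lemma erlangADeparture_le {μ θ : ℝ} (hμ : 0 < μ) (hθ : 0 ≤ θ) (c n : ℕ) :
    erlangADeparture μ θ c n ≤ (μ + θ) * n := by
  unfold erlangADeparture
  have h1 : min (n : ℝ) c ≤ n := min_le_left _ _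
  have h2 : max ((n : ℝ) - c) 0 ≤ n := max_le (by simp) (by positivity)
  nlinarith [mul_le_mul_of_nonneg_left h1 hμ.le, mul_le_mul_of_nonneg_left h2 hθ]

lemma erlangADeparture_eq (μ θ : ℝ) (c n : ℕ) :
    erlangADeparture μ θ c n = θ * n + (μ - θ) * min (n : ℝ) c := by
  unfold erlangADeparture
  rcases le_total (n : ℝ) c with h | h
  · rw [min_eq_left h, max_eq_right (by linarith)]; ring
  · rw [min_eq_right h, max_eq_left (by linarith)]; ring

lemma abs_erlangAGenerator_le {μ θ : ℝ} (hμ : 0 < μ) (hθ : 0 ≤ θ) (c : ℕ) {r R : ℝ}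
    (hr : 0 ≤ r) (hrR : r ≤ R) (f : ℕ → ℝ) (n : ℕ) :
    |erlangAGenerator r μ θ c f n| ≤ R * |f (n + 1) - f n| +
      erlangADeparture μ θ c n * |f (n - 1) - f n| := by
  unfold erlangAGenerator
  refine (abs_add_le _ _).trans ?_
  rw [abs_mul, abs_mul, abs_of_nonneg hr, abs_of_nonneg (erlangADeparture_nonneg hμ hθ c n)]
  gcongr

lemma exists_bound_of_finite_support {f : ℕ → ℝ} (hf : f.support.Finite) :
    ∃ C, ∀ n, |f n| ≤ C := by
  obtain ⟨C, hC⟩ := (hf.image fun n => |f n|).bddAbove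
  refine ⟨max C 0, fun n => ?_⟩
  by_cases h : f n = 0
  · simp [h]
  · exact le_max_of_le_left (hC ⟨n, h, rfl⟩)

/-- The departure rate is unbounded, but it multiplies a difference of `f` that vanishes beyond the
support. -/
lemma exists_generator_bound_of_finite_support {μ θ : ℝ} (hμ : 0 < μ) (hθ : 0 ≤ θ) (c : ℕ)
    {f : ℕ → ℝ} (hf : f.support.Finite) (R : ℝ) :
    ∃ C, ∀ r, 0 ≤ r → r ≤ R → ∀ n, |erlangAGenerator r μ θ c f n| ≤ C := by
  obtain ⟨A, hA⟩ := exists_bound_of_finite_support hf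
  have hA0 : 0 ≤ A := (abs_nonneg _).trans (hA 0)
  obtain ⟨N, hN⟩ := hf.bddAbove
  refine ⟨R * (A + A) + (μ + θ) * (N + 1) * (A + A), fun r hr hrR n => ?_⟩
  refine (abs_erlangAGenerator_le hμ hθ c hr hrR f n).trans ?_
  have hR : 0 ≤ R := hr.trans hrR
  have hb : ∀ m k, |f m - f k| ≤ A + A := fun m k =>
    (abs_sub _ _).trans (add_le_add (hA m) (hA k))
  refine add_le_add (by gcongr; exact hb _ _) ?_
  -- For n > N + 1 both n and n - 1 exceed every point of the support.
  rcases le_or_gt n (N + 1) with h | h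
  · have h' : (n : ℝ) ≤ N + 1 := by exact_mod_cast h
    refine mul_le_mul ((erlangADeparture_le hμ hθ c n).trans ?_) (hb _ _) (abs_nonneg _)
      (by positivity)
    gcongr
  · have h0 : ∀ m, N < m → f m = 0 := fun m hm => by
      by_contra hne
      exact absurd (hN hne) (not_le.2 hm)
    rw [h0 n (by omega), h0 (n - 1) (by omega)]
    simp only [sub_self, abs_zero, mul_zero]
    positivity

variable {P : Measure Ω} [IsProbabilityMeasure P] {ℱ : Filtration ℝ≥0 mΩ} {lam : ℝ → ℝ}
  {μ θ : ℝ} {c : ℕ} {Q : ℝ≥0 → Ω → ℕ}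

omit [IsProbabilityMeasure P] in
lemma IsErlangA.measurable (hQ : IsErlangA P ℱ lam μ θ c Q) (t : ℝ≥0) : Measurable (Q t) :=
  (hQ.adapted t).mono (ℱ.le t) le_rfl

omit [IsProbabilityMeasure P] in
lemma IsErlangA.measurable_uncurry (hQ : IsErlangA P ℱ lam μ θ c Q) :
    Measurable (fun x : ℝ × Ω => Q x.1.toNNReal x.2) :=
  (measurable_uncurry_of_rightContinuous hQ.measurable hQ.right_continuous).comp
    ((measurable_real_toNNReal.comp measurable_fst).prodMk measurable_snd)

omit [IsProbabilityMeasure P] in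
lemma IsErlangA.measurable_comp (hQ : IsErlangA P ℱ lam μ θ c Q) (f : ℕ → ℝ) (t : ℝ≥0) :
    Measurable (fun ω => f (Q t ω)) :=
  (measurable_from_nat (f := f)).comp (hQ.measurable t)

omit [IsProbabilityMeasure P] in
lemma IsErlangA.measurable_generator (hQ : IsErlangA P ℱ lam μ θ c Q) (hlam : Continuous lam)
    (f : ℕ → ℝ) :
    Measurable (fun x : ℝ × Ω => erlangAGenerator (lam x.1) μ θ c f (Q x.1.toNNReal x.2)) := by
  unfold erlangAGenerator
  have h := hQ.measurable_uncurry
  have h1 : ∀ g : ℕ → ℝ, Measurable (fun x : ℝ × Ω => g (Q x.1.toNNReal x.2)) := fun g =>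
    (measurable_from_nat (f := g)).comp h
  exact ((hlam.measurable.comp measurable_fst).mul (h1 fun n => f (n + 1) - f n)).add
    (h1 fun n => erlangADeparture μ θ c n * (f (n - 1) - f n))

lemma IsErlangA.stronglyMeasurable_integral_generator (hQ : IsErlangA P ℱ lam μ θ c Q)
    (hlam : Continuous lam) (f : ℕ → ℝ) :
    StronglyMeasurable (fun s : ℝ =>
      ∫ ω, erlangAGenerator (lam s) μ θ c f (Q s.toNNReal ω) ∂P) :=
  (hQ.measurable_generator hlam f).stronglyMeasurable.integral_prod_right

lemma exists_uIcc_bound (hlam : Continuous lam) (a b : ℝ) : ∃ R, ∀ s ∈ uIcc a b, lam s ≤ R := by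
  obtain ⟨R, hR⟩ := isCompact_uIcc.bddAbove_image (hlam.continuousOn (s := uIcc a b))
  exact ⟨R, fun s hs => hR ⟨s, hs, rfl⟩⟩

/-- Dynkin's formula for finitely supported functions. -/
lemma IsErlangA.dynkin_of_finite_support (hQ : IsErlangA P ℱ lam μ θ c Q)
    (hlam : Continuous lam) (hlam0 : ∀ s, 0 ≤ lam s) (hμ : 0 < μ) (hθ : 0 ≤ θ)
    {f : ℕ → ℝ} (hf : f.support.Finite) (t : ℝ≥0) :
    ∫ ω, f (Q t ω) ∂P = ∫ ω, f (Q 0 ω) ∂P + ∫ s in (0 : ℝ)..t,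
      ∫ ω, erlangAGenerator (lam s) μ θ c f (Q s.toNNReal ω) ∂P := by
  obtain ⟨A, hA⟩ := exists_bound_of_finite_support hf
  obtain ⟨R, hR⟩ := exists_uIcc_bound hlam 0 t
  obtain ⟨C, hC⟩ := exists_generator_bound_of_finite_support hμ hθ c hf R
  have hint : ∀ s, Integrable (fun ω => f (Q s ω)) P := fun s =>
    Integrable.of_bound (hQ.measurable_comp f s).aestronglyMeasurable A
      (Eventually.of_forall fun ω => hA _)
  have hprod : Integrable (Function.uncurry fun (s : ℝ) ω =>
      erlangAGenerator (lam s) μ θ c f (Q s.toNNReal ω))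
      ((volume.restrict (uIoc (0 : ℝ) t)).prod P) := by
    have : IsFiniteMeasure ((volume : Measure ℝ).restrict (uIoc (0 : ℝ) t)) :=
      ⟨by simp [uIoc]⟩
    refine Integrable.of_bound (hQ.measurable_generator hlam f).aestronglyMeasurable C ?_
    have h1 : ∀ᵐ x ∂((volume.restrict (uIoc (0 : ℝ) t)).prod P), x.1 ∈ uIoc (0 : ℝ) t :=
      Measure.quasiMeasurePreserving_fst.ae (ae_restrict_mem measurableSet_uIoc)
    filter_upwards [h1] with x hx
    exact hC _ (hlam0 _) (hR _ (uIoc_subset_uIcc hx)) _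
  have hm := (hQ.martingale f hf).setIntegral_eq (show 0 ≤ t from t.2) (MeasurableSet.univ)
  simp only [setIntegral_univ, NNReal.coe_zero, intervalIntegral.integral_same, sub_zero] at hm
  rw [hm, integral_sub (hint t), intervalIntegral_integral_swap hprod]
  · ring
  · have := hprod.integral_prod_right
    rw [uIoc_of_le t.coe_nonneg] at this
    refine this.congr (Eventually.of_forall fun ω => ?_)
    exact (intervalIntegral.integral_of_le t.coe_nonneg).symm

end ErlangA

/-! ### Propagation of exponential moments -/

section Moments

lemma intervalIntegrable_of_stronglyMeasurable_of_bound {G : ℝ → ℝ} (hG : StronglyMeasurable G)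
    {a b C : ℝ} (hC : ∀ s ∈ uIcc a b, |G s| ≤ C) : IntervalIntegrable G volume a b := by
  rw [intervalIntegrable_iff]
  refine Measure.integrableOn_of_bounded (M := C) (by simp [uIoc]) hG.aestronglyMeasurable ?_
  filter_upwards [ae_restrict_mem measurableSet_uIoc] with s hs
  exact hC s (uIoc_subset_uIcc hs)

lemma continuous_toNNReal_of_eq_add_integral {u : ℝ≥0 → ℝ} {G : ℝ → ℝ} {u₀ : ℝ}
    (hu : ∀ t : ℝ≥0, u t = u₀ + ∫ s in (0 : ℝ)..t, G s)
    (hG : ∀ a b, IntervalIntegrable G volume a b) :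
    Continuous (fun s : ℝ => u s.toNNReal) := by
  simp only [hu]
  exact continuous_const.add ((intervalIntegral.continuous_primitive hG 0).comp
    (NNReal.continuous_coe.comp continuous_real_toNNReal))

/-- Grönwall's inequality in integral form. -/
lemma le_mul_exp_of_le_add_integral {U : ℝ → ℝ} (hU : Continuous U) {u₀ K T : ℝ} (hK : 0 ≤ K)
    (h : ∀ t ∈ Icc 0 T, U t ≤ u₀ + ∫ s in (0 : ℝ)..t, K * U s) :
    ∀ t ∈ Icc 0 T, U t ≤ u₀ * Real.exp (K * t) := by
  set φ : ℝ → ℝ := fun t => u₀ + ∫ s in (0 : ℝ)..t, K * U s with hφ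
  have hd : ∀ t, HasDerivAt φ (K * U t) t := fun t =>
    ((continuous_const.mul hU).integral_hasStrictDerivAt 0 t).hasDerivAt.const_add u₀
  have hψ : ∀ t, HasDerivAt (fun t => φ t * Real.exp (-(K * t)))
      (K * U t * Real.exp (-(K * t)) + φ t * (Real.exp (-(K * t)) * -(K * 1))) t := fun t =>
    (hd t).mul (((hasDerivAt_id t).const_mul K).neg.exp)
  have hanti : AntitoneOn (fun t => φ t * Real.exp (-(K * t))) (Icc 0 T) := by
    refine antitoneOn_of_deriv_nonpos (convex_Icc _ _)
      (fun t _ => (hψ t).continuousAt.continuousWithinAt)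
      (fun t _ => (hψ t).differentiableAt.differentiableWithinAt) fun t ht => ?_
    rw [interior_Icc] at ht
    rw [(hψ t).deriv]
    have h1 := h t ⟨ht.1.le, ht.2.le⟩
    have h2 : 0 ≤ K * Real.exp (-(K * t)) := by positivity
    nlinarith [mul_le_mul_of_nonneg_left h1 h2]
  intro t ht
  have h1 := hanti ⟨le_rfl, ht.1.trans ht.2⟩ ht ht.1
  have h0 : φ 0 = u₀ := by simp [hφ]
  simp only [h0, mul_zero, neg_zero, Real.exp_zero, mul_one] at h1
  calc U t ≤ φ t := h t ht
    _ = φ t * Real.exp (-(K * t)) * Real.exp (K * t) := by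
      rw [mul_assoc, ← Real.exp_add]; simp
    _ ≤ _ := by gcongr

lemma erlangAGenerator_sub_const (r μ θ : ℝ) (c : ℕ) (f : ℕ → ℝ) (a : ℝ) (n : ℕ) :
    erlangAGenerator r μ θ c (fun m => f m - a) n = erlangAGenerator r μ θ c f n := by
  simp [erlangAGenerator]

/-- The truncated exponential is nondecreasing, so departures only lower it, and an arrival
multiplies it by at most e^b. The bound is therefore free of the unbounded departure rate and
uniform in `N`, as Grönwall requires. -/
lemma erlangAGenerator_exp_min_le {r μ θ : ℝ} (hr : 0 ≤ r) (hμ : 0 < μ) (hθ : 0 ≤ θ) (c : ℕ)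
    {b : ℝ} (hb : 0 ≤ b) (N n : ℕ) :
    erlangAGenerator r μ θ c (fun m => Real.exp (b * (min m N : ℕ))) n ≤
      r * ((Real.exp b - 1) * Real.exp (b * (min n N : ℕ))) := by
  have h1 : Real.exp (b * (min (n + 1) N : ℕ)) - Real.exp (b * (min n N : ℕ)) ≤
      (Real.exp b - 1) * Real.exp (b * (min n N : ℕ)) := by
    have : Real.exp (b * (min (n + 1) N : ℕ)) ≤ Real.exp b * Real.exp (b * (min n N : ℕ)) := by
      rw [← Real.exp_add]
      have : ((min (n + 1) N : ℕ) : ℝ) ≤ (min n N : ℕ) + 1 := by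
        exact_mod_cast (by omega : min (n + 1) N ≤ min n N + 1)
      gcongr
      nlinarith
    linarith
  have h2 : Real.exp (b * (min (n - 1) N : ℕ)) - Real.exp (b * (min n N : ℕ)) ≤ 0 := by
    have : min (n - 1) N ≤ min n N := by omega
    have : Real.exp (b * (min (n - 1) N : ℕ)) ≤ Real.exp (b * (min n N : ℕ)) := by gcongr
    linarith
  unfold erlangAGenerator
  have h3 := mul_le_mul_of_nonneg_left h1 hr
  have h4 := mul_nonpos_of_nonneg_of_nonpos (erlangADeparture_nonneg hμ hθ c n) h2
  linarith

variable {Ω : Type*} [mΩ : MeasurableSpace Ω]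
  {P : Measure Ω} [IsProbabilityMeasure P] {ℱ : Filtration ℝ≥0 mΩ} {lam : ℝ → ℝ}
  {μ θ : ℝ} {c : ℕ} {Q : ℝ≥0 → Ω → ℕ}

lemma IsErlangA.intervalIntegrable_of_finite_support (hQ : IsErlangA P ℱ lam μ θ c Q)
    (hlam : Continuous lam) (hlam0 : ∀ s, 0 ≤ lam s) (hμ : 0 < μ) (hθ : 0 ≤ θ)
    {f : ℕ → ℝ} (hf : f.support.Finite) (a b : ℝ) :
    IntervalIntegrable (fun s => ∫ ω, erlangAGenerator (lam s) μ θ c f (Q s.toNNReal ω) ∂P)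
      volume a b := by
  obtain ⟨R, hR⟩ := exists_uIcc_bound hlam a b
  obtain ⟨C, hC⟩ := exists_generator_bound_of_finite_support hμ hθ c hf R
  refine intervalIntegrable_of_stronglyMeasurable_of_bound
    (hQ.stronglyMeasurable_integral_generator hlam f) (C := C) fun s hs => ?_
  have h : ∀ᵐ ω ∂P, ‖erlangAGenerator (lam s) μ θ c f (Q s.toNNReal ω)‖ ≤ C :=
    Eventually.of_forall fun ω => hC _ (hlam0 s) (hR s hs) (Q s.toNNReal ω)
  simpa using norm_integral_le_of_norm_le_const h

/-- Exponential moments of the truncated queue length grow at most exponentially. -/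
lemma IsErlangA.integral_exp_min_le (hQ : IsErlangA P ℱ lam μ θ c Q)
    (hlam : Continuous lam) (hlam0 : ∀ s, 0 ≤ lam s) (hμ : 0 < μ) (hθ : 0 ≤ θ)
    {b R T : ℝ} (hb : 0 ≤ b) (hR0 : 0 ≤ R) (hR : ∀ s ∈ Icc 0 T, lam s ≤ R) (N : ℕ)
    (t : ℝ≥0) (ht : (t : ℝ) ≤ T) :
    ∫ ω, Real.exp (b * (min (Q t ω) N : ℕ)) ∂P ≤
      (∫ ω, Real.exp (b * (min (Q 0 ω) N : ℕ)) ∂P) * Real.exp (R * (Real.exp b - 1) * t) := by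
  set f : ℕ → ℝ := fun m => Real.exp (b * (min m N : ℕ)) with hf
  -- `f` is constant from `N` on; subtracting that constant gives finite support and leaves the
  -- generator unchanged.
  set g : ℕ → ℝ := fun m => f m - Real.exp (b * N) with hg
  have hgs : g.support.Finite := by
    refine (finite_Iio N).subset fun m hm => ?_
    by_contra h
    have : min m N = N := min_eq_right (not_lt.1 h)
    exact hm (by simp only [hg, hf, this, sub_self])
  have hfb : ∀ m, |f m| ≤ Real.exp (b * N) := fun m => by
    rw [abs_of_pos (Real.exp_pos _)]
    have : min m N ≤ N := min_le_right _ _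
    show Real.exp _ ≤ _
    gcongr
  have hfi : ∀ s, Integrable (fun ω => f (Q s ω)) P := fun s =>
    Integrable.of_bound (hQ.measurable_comp f s).aestronglyMeasurable _
      (Eventually.of_forall fun ω => hfb _)
  set G : ℝ → ℝ := fun s => ∫ ω, erlangAGenerator (lam s) μ θ c g (Q s.toNNReal ω) ∂P with hG
  have hGi : ∀ a b, IntervalIntegrable G volume a b :=
    hQ.intervalIntegrable_of_finite_support hlam hlam0 hμ hθ hgs
  have hu : ∀ s : ℝ≥0, ∫ ω, f (Q s ω) ∂P = ∫ ω, f (Q 0 ω) ∂P + ∫ x in (0 : ℝ)..s, G x := by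
    intro s
    have h := hQ.dynkin_of_finite_support hlam hlam0 hμ hθ hgs s
    simp only [hg] at h
    rw [integral_sub (hfi s) (integrable_const _), integral_sub (hfi 0) (integrable_const _)] at h
    linarith
  have hUc := continuous_toNNReal_of_eq_add_integral hu hGi
  have hK : 0 ≤ R * (Real.exp b - 1) :=
    mul_nonneg hR0 (by linarith [Real.add_one_le_exp b])
  have hGle : ∀ s ∈ Icc 0 T, G s ≤ R * (Real.exp b - 1) * ∫ ω, f (Q s.toNNReal ω) ∂P := by
    intro s hs
    obtain ⟨C, hC⟩ := exists_generator_bound_of_finite_support hμ hθ c hgs R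
    rw [← integral_const_mul]
    refine integral_mono (Integrable.of_bound ?_ C (Eventually.of_forall fun ω =>
      hC _ (hlam0 s) (hR s hs) _)) ((hfi _).const_mul _) fun ω => ?_
    · exact (hQ.measurable_comp (erlangAGenerator (lam s) μ θ c g) _).aestronglyMeasurable
    · simp only [hg]
      rw [erlangAGenerator_sub_const]
      refine (erlangAGenerator_exp_min_le (hlam0 s) hμ hθ c hb N _).trans ?_
      rw [mul_assoc]
      have : 0 ≤ (Real.exp b - 1) * Real.exp (b * (min (Q s.toNNReal ω) N : ℕ)) :=
        mul_nonneg (by linarith [Real.add_one_le_exp b]) (Real.exp_pos _).le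
      exact mul_le_mul_of_nonneg_right (hR s hs) this
  have := le_mul_exp_of_le_add_integral hUc hK (u₀ := ∫ ω, f (Q 0 ω) ∂P) (T := T)
    (fun s hs => ?_) t ⟨t.coe_nonneg, ht⟩
  · simpa only [Real.toNNReal_coe] using this
  · rw [hu, Real.coe_toNNReal _ hs.1]
    gcongr
    refine intervalIntegral.integral_mono_on hs.1 (hGi _ _)
      ((continuous_const.mul hUc).intervalIntegrable _ _) fun x hx => ?_
    exact hGle x ⟨hx.1, hx.2.trans hs.2⟩

/-- Exponential moments of the initial state propagate, uniformly on bounded time intervals. -/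
lemma IsErlangA.exists_exp_moment_bound (hQ : IsErlangA P ℱ lam μ θ c Q)
    (hlam : Continuous lam) (hlam0 : ∀ s, 0 ≤ lam s) (hμ : 0 < μ) (hθ : 0 ≤ θ)
    {b : ℝ} (hb : 0 ≤ b) (h0 : Integrable (fun ω => Real.exp (b * (Q 0 ω : ℝ))) P) (T : ℝ) :
    ∃ B, ∀ t : ℝ≥0, (t : ℝ) ≤ T → Integrable (fun ω => Real.exp (b * (Q t ω : ℝ))) P ∧
      ∫ ω, Real.exp (b * (Q t ω : ℝ)) ∂P ≤ B := by
  obtain ⟨R', hR'⟩ := exists_uIcc_bound hlam 0 T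
  set R := max R' 0
  have hR : ∀ s ∈ Icc 0 T, lam s ≤ R := fun s hs =>
    (hR' s (Icc_subset_uIcc hs)).trans (le_max_left _ _)
  have hR0 : 0 ≤ R := le_max_right _ _
  set B := (∫ ω, Real.exp (b * (Q 0 ω : ℝ)) ∂P) * Real.exp (R * (Real.exp b - 1) * T) with hB
  have hmeas : ∀ (N : ℕ) t, Measurable fun ω => Real.exp (b * (min (Q t ω) N : ℕ)) :=
    fun N t => hQ.measurable_comp (fun m => Real.exp (b * (min m N : ℕ))) t
  have hmeas' : ∀ t, Measurable fun ω => Real.exp (b * (Q t ω : ℝ)) :=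
    fun t => hQ.measurable_comp (fun m => Real.exp (b * m)) t
  have hint : ∀ (N : ℕ) t, Integrable (fun ω => Real.exp (b * (min (Q t ω) N : ℕ))) P := fun N t =>
    Integrable.of_bound (hmeas N t).aestronglyMeasurable (Real.exp (b * N))
      (Eventually.of_forall fun ω => by
        rw [Real.norm_of_nonneg (Real.exp_pos _).le]
        have : min (Q t ω) N ≤ N := min_le_right _ _
        gcongr)
  have hbound : ∀ (N : ℕ) (t : ℝ≥0), (t : ℝ) ≤ T →
      ∫ ω, Real.exp (b * (min (Q t ω) N : ℕ)) ∂P ≤ B := by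
    intro N t ht
    refine (hQ.integral_exp_min_le hlam hlam0 hμ hθ hb hR0 hR N t ht).trans ?_
    have hK : 0 ≤ R * (Real.exp b - 1) :=
      mul_nonneg hR0 (by linarith [Real.add_one_le_exp b])
    refine mul_le_mul (integral_mono (hint N 0) h0 fun ω => ?_) (by gcongr) (Real.exp_pos _).le
      (integral_nonneg fun ω => (Real.exp_pos _).le)
    have : min (Q 0 ω) N ≤ Q 0 ω := min_le_left _ _
    simp only
    gcongr
  refine ⟨B, fun t ht => ?_⟩
  -- Monotone convergence in the truncation level: as `B` does not depend on `N`, it yields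
  -- integrability and the bound together.
  have hlim := lintegral_tendsto_of_tendsto_of_monotone (μ := P)
    (f := fun (N : ℕ) ω => ENNReal.ofReal (Real.exp (b * (min (Q t ω) N : ℕ))))
    (F := fun ω => ENNReal.ofReal (Real.exp (b * (Q t ω : ℝ))))
    (fun N => (hmeas N t).ennreal_ofReal.aemeasurable)
    (Eventually.of_forall fun ω N M hNM => ENNReal.ofReal_le_ofReal (by
      have : min (Q t ω) N ≤ min (Q t ω) M := min_le_min le_rfl hNM
      gcongr))
    (Eventually.of_forall fun ω => tendsto_atTop_of_eventually_const (i₀ := Q t ω) fun N hN => by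
      rw [min_eq_left hN])
  have hle : ∫⁻ ω, ENNReal.ofReal (Real.exp (b * (Q t ω : ℝ))) ∂P ≤ ENNReal.ofReal B := by
    refine le_of_tendsto' hlim fun N => ?_
    rw [← ofReal_integral_eq_lintegral_ofReal (hint N t)
      (Eventually.of_forall fun ω => (Real.exp_pos _).le)]
    exact ENNReal.ofReal_le_ofReal (hbound N t ht)
  have hB0 : 0 ≤ B := mul_nonneg (integral_nonneg fun ω => (Real.exp_pos _).le) (Real.exp_pos _).le
  refine ⟨⟨(hmeas' t).aestronglyMeasurable, ?_⟩, ?_⟩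
  · rw [hasFiniteIntegral_iff_ofReal (Eventually.of_forall fun ω => (Real.exp_pos _).le)]
    exact hle.trans_lt ENNReal.ofReal_lt_top
  · rw [integral_eq_lintegral_of_nonneg_ae (Eventually.of_forall fun ω => (Real.exp_pos _).le)
      (hmeas' t).aestronglyMeasurable]
    exact ENNReal.toReal_le_of_le_ofReal hB0 hle

end Moments

/-! ### Dynkin's formula and the forward equation under exponential growth -/

section Dynkin

/-- From x ≤ e^x at x = (b - β)n. It absorbs the linear departure rate at the price of raising the
exponent from `β` to `b`. -/
lemma natCast_mul_exp_le {β b : ℝ} (hβ : β < b) (n : ℕ) :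
    n * Real.exp (β * n) ≤ 1 / (b - β) * Real.exp (b * n) := by
  have hbβ : 0 < b - β := by linarith
  have h1 : (b - β) * n ≤ Real.exp ((b - β) * n) := by
    linarith [Real.add_one_le_exp ((b - β) * n)]
  have h2 : Real.exp (b * n) = Real.exp ((b - β) * n) * Real.exp (β * n) := by
    rw [← Real.exp_add]; ring_nf
  rw [h2, div_mul_eq_mul_div, one_mul, le_div_iff₀ hbβ]
  nlinarith [mul_le_mul_of_nonneg_right h1 (Real.exp_pos (β * n)).le]

/-- `K` is chosen before `f`, so that a single dominating function serves all truncations of a given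
function. -/
lemma exists_generator_bound_of_exp_growth {μ θ : ℝ} (hμ : 0 < μ) (hθ : 0 ≤ θ) (c : ℕ)
    {C β b : ℝ} (hβ : β < b) (R : ℝ) :
    ∃ K, ∀ f : ℕ → ℝ, (∀ n, |f n| ≤ C * Real.exp (β * n)) → ∀ r, 0 ≤ r → r ≤ R → ∀ n,
      |erlangAGenerator r μ θ c f n| ≤ K * Real.exp (b * n) := by
  refine ⟨R * (C * Real.exp β + C) + (μ + θ) * (C * Real.exp |β| + C) * (1 / (b - β)),
    fun f hf r hr hrR n => ?_⟩
  have hC : 0 ≤ C := by simpa using (abs_nonneg _).trans (hf 0)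
  have hR : 0 ≤ R := hr.trans hrR
  have hbβ : 0 < b - β := by linarith
  refine (abs_erlangAGenerator_le hμ hθ c hr hrR f n).trans ?_
  have hup : |f (n + 1) - f n| ≤ (C * Real.exp β + C) * Real.exp (β * n) := by
    refine (abs_sub _ _).trans ((add_le_add (hf _) (hf _)).trans (le_of_eq ?_))
    push_cast
    rw [mul_add, mul_one, Real.exp_add]; ring
  have hdown : |f (n - 1) - f n| ≤ (C * Real.exp |β| + C) * Real.exp (β * n) := by
    refine (abs_sub _ _).trans ?_
    have h1 : Real.exp (β * (n - 1 : ℕ)) ≤ Real.exp |β| * Real.exp (β * n) := by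
      rw [← Real.exp_add]
      gcongr
      rcases n with _ | n
      · simp
      · rw [Nat.add_sub_cancel]
        push_cast
        nlinarith [neg_abs_le β]
    nlinarith [hf (n - 1), hf n, mul_le_mul_of_nonneg_left h1 hC]
  have hexp : Real.exp (β * n) ≤ Real.exp (b * n) := by gcongr
  have hn := natCast_mul_exp_le hβ n
  calc R * |f (n + 1) - f n| + erlangADeparture μ θ c n * |f (n - 1) - f n|
      ≤ R * ((C * Real.exp β + C) * Real.exp (β * n)) +
        ((μ + θ) * n) * ((C * Real.exp |β| + C) * Real.exp (β * n)) := by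
        gcongr
        exact erlangADeparture_le hμ hθ c n
    _ = R * (C * Real.exp β + C) * Real.exp (β * n) +
        (μ + θ) * (C * Real.exp |β| + C) * (n * Real.exp (β * n)) := by ring
    _ ≤ R * (C * Real.exp β + C) * Real.exp (b * n) +
        (μ + θ) * (C * Real.exp |β| + C) * (1 / (b - β) * Real.exp (b * n)) := by gcongr
    _ = _ := by ring

variable {Ω : Type*} [mΩ : MeasurableSpace Ω]
  {P : Measure Ω} [IsProbabilityMeasure P] {ℱ : Filtration ℝ≥0 mΩ} {lam : ℝ → ℝ}
  {μ θ : ℝ} {c : ℕ} {Q : ℝ≥0 → Ω → ℕ} {f : ℕ → ℝ} {C β b : ℝ}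

omit [IsProbabilityMeasure P] in
lemma IsErlangA.integrable_comp (hQ : IsErlangA P ℱ lam μ θ c Q) {t : ℝ≥0}
    (ht : Integrable (fun ω => Real.exp (b * (Q t ω : ℝ))) P)
    (hf : ∀ n, |f n| ≤ C * Real.exp (b * n)) : Integrable (fun ω => f (Q t ω)) P :=
  (ht.const_mul C).mono' (hQ.measurable_comp f t).aestronglyMeasurable
    (Eventually.of_forall fun _ => hf _)

lemma IsErlangA.exists_integral_generator_bound (hQ : IsErlangA P ℱ lam μ θ c Q)
    (hlam : Continuous lam) (hlam0 : ∀ s, 0 ≤ lam s) (hμ : 0 < μ) (hθ : 0 ≤ θ)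
    (hb : 0 ≤ b) (h0 : Integrable (fun ω => Real.exp (b * (Q 0 ω : ℝ))) P) (hβ : β < b)
    (C x y : ℝ) :
    ∃ K, ∀ f : ℕ → ℝ, (∀ n, |f n| ≤ C * Real.exp (β * n)) → ∀ s ∈ uIcc x y,
      |∫ ω, erlangAGenerator (lam s) μ θ c f (Q s.toNNReal ω) ∂P| ≤ K := by
  obtain ⟨R, hR⟩ := exists_uIcc_bound hlam x y
  obtain ⟨B, hB⟩ := hQ.exists_exp_moment_bound hlam hlam0 hμ hθ hb h0 (max 0 (max x y))
  obtain ⟨K, hK⟩ := exists_generator_bound_of_exp_growth hμ hθ c (C := C) hβ R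
  refine ⟨K * B, fun f hf s hs => ?_⟩
  have hK0 : 0 ≤ K := by
    have := (abs_nonneg _).trans (hK f hf _ (hlam0 s) (hR s hs) 0)
    simpa using this
  obtain ⟨hi, hle⟩ := hB s.toNNReal (by
    rw [Real.coe_toNNReal', max_comm]
    exact max_le_max le_rfl hs.2)
  have h : ∀ᵐ ω ∂P, ‖erlangAGenerator (lam s) μ θ c f (Q s.toNNReal ω)‖ ≤
      K * Real.exp (b * (Q s.toNNReal ω : ℝ)) :=
    Eventually.of_forall fun ω => hK f hf _ (hlam0 s) (hR s hs) _
  refine (norm_integral_le_of_norm_le (hi.const_mul K) h).trans ?_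
  rw [integral_const_mul]
  gcongr

lemma IsErlangA.intervalIntegrable_of_exp_growth (hQ : IsErlangA P ℱ lam μ θ c Q)
    (hlam : Continuous lam) (hlam0 : ∀ s, 0 ≤ lam s) (hμ : 0 < μ) (hθ : 0 ≤ θ)
    (hb : 0 ≤ b) (h0 : Integrable (fun ω => Real.exp (b * (Q 0 ω : ℝ))) P) (hβ : β < b)
    (hf : ∀ n, |f n| ≤ C * Real.exp (β * n)) (x y : ℝ) :
    IntervalIntegrable (fun s => ∫ ω, erlangAGenerator (lam s) μ θ c f (Q s.toNNReal ω) ∂P)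
      volume x y := by
  obtain ⟨K, hK⟩ := hQ.exists_integral_generator_bound hlam hlam0 hμ hθ hb h0 hβ C x y
  exact intervalIntegrable_of_stronglyMeasurable_of_bound
    (hQ.stronglyMeasurable_integral_generator hlam f) (hK f hf)

/-- Dynkin's formula for functions of exponential growth. -/
lemma IsErlangA.dynkin_of_exp_growth (hQ : IsErlangA P ℱ lam μ θ c Q)
    (hlam : Continuous lam) (hlam0 : ∀ s, 0 ≤ lam s) (hμ : 0 < μ) (hθ : 0 ≤ θ)
    (hb : 0 ≤ b) (h0 : Integrable (fun ω => Real.exp (b * (Q 0 ω : ℝ))) P) (hβ : β < b)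
    (hf : ∀ n, |f n| ≤ C * Real.exp (β * n)) (t : ℝ≥0) :
    ∫ ω, f (Q t ω) ∂P = ∫ ω, f (Q 0 ω) ∂P + ∫ s in (0 : ℝ)..t,
      ∫ ω, erlangAGenerator (lam s) μ θ c f (Q s.toNNReal ω) ∂P := by
  set F : ℕ → ℕ → ℝ := fun N => (Iio N).indicator f with hF
  have hFs : ∀ N, (F N).support.Finite := fun N =>
    (finite_Iio N).subset (by simp [hF])
  have hFf : ∀ N n, |F N n| ≤ |f n| := fun N n => norm_indicator_le_norm_self f n
  have hFb : ∀ N n, |F N n| ≤ C * Real.exp (β * n) := fun N n => (hFf N n).trans (hf n)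
  have hFe : ∀ n, ∀ N, n < N → F N n = f n := fun n N hN => indicator_of_mem (mem_Iio.2 hN) f
  have hC : 0 ≤ C := by simpa using (abs_nonneg _).trans (hf 0)
  have hint : ∀ s : ℝ≥0, Integrable (fun ω => Real.exp (b * (Q s ω : ℝ))) P := fun s => by
    obtain ⟨B, hB⟩ := hQ.exists_exp_moment_bound hlam hlam0 hμ hθ hb h0 s
    exact (hB s le_rfl).1
  have hlim : ∀ s : ℝ≥0, Tendsto (fun N => ∫ ω, F N (Q s ω) ∂P) atTop (𝓝 (∫ ω, f (Q s ω) ∂P)) := by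
    intro s
    refine tendsto_integral_of_dominated_convergence
      (fun ω => C * Real.exp (b * (Q s ω : ℝ))) (fun N => ?_) ((hint s).const_mul C)
      (fun N => Eventually.of_forall fun ω => (hFb N _).trans ?_)
      (Eventually.of_forall fun ω => tendsto_atTop_of_eventually_const (i₀ := Q s ω + 1)
        fun N hN => hFe _ _ (by omega))
    · exact (hQ.measurable_comp (F N) s).aestronglyMeasurable
    · gcongr
  have hlimG : ∀ s : ℝ, Tendsto
      (fun N => ∫ ω, erlangAGenerator (lam s) μ θ c (F N) (Q s.toNNReal ω) ∂P) atTop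
      (𝓝 (∫ ω, erlangAGenerator (lam s) μ θ c f (Q s.toNNReal ω) ∂P)) := by
    intro s
    obtain ⟨K, hK⟩ := exists_generator_bound_of_exp_growth hμ hθ c (C := C) hβ (lam s)
    refine tendsto_integral_of_dominated_convergence
      (fun ω => K * Real.exp (b * (Q s.toNNReal ω : ℝ))) (fun N => ?_) ((hint _).const_mul K)
      (fun N => Eventually.of_forall fun ω => hK _ (hFb N) _ (hlam0 s) le_rfl _)
      (Eventually.of_forall fun ω => tendsto_atTop_of_eventually_const
        -- The generator at n looks at n + 1, which lies in `Iio N` once N ≥ n + 2.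
        (i₀ := Q s.toNNReal ω + 2) fun N hN => ?_)
    · exact (hQ.measurable_comp (erlangAGenerator (lam s) μ θ c (F N)) _).aestronglyMeasurable
    · unfold erlangAGenerator
      rw [hFe _ N (by omega), hFe _ N (by omega), hFe _ N (by omega)]
  obtain ⟨K, hK⟩ := hQ.exists_integral_generator_bound hlam hlam0 hμ hθ hb h0 hβ C 0 t
  have hlimI := intervalIntegral.tendsto_integral_filter_of_dominated_convergence
    (μ := volume) (a := 0) (b := t) (l := atTop)
    (F := fun (N : ℕ) s => ∫ ω, erlangAGenerator (lam s) μ θ c (F N) (Q s.toNNReal ω) ∂P)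
    (f := fun s => ∫ ω, erlangAGenerator (lam s) μ θ c f (Q s.toNNReal ω) ∂P) (fun _ => K)
    (Eventually.of_forall fun N =>
      (hQ.stronglyMeasurable_integral_generator hlam (F N)).aestronglyMeasurable)
    (Eventually.of_forall fun N => Eventually.of_forall fun s hs =>
      hK _ (hFb N) s (uIoc_subset_uIcc hs))
    intervalIntegrable_const (Eventually.of_forall fun s _ => hlimG s)
  refine tendsto_nhds_unique (hlim t) (((hlim 0).add hlimI).congr fun N => ?_)
  exact (hQ.dynkin_of_finite_support hlam hlam0 hμ hθ (hFs N) t).symm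

lemma IsErlangA.continuous_integral_comp (hQ : IsErlangA P ℱ lam μ θ c Q)
    (hlam : Continuous lam) (hlam0 : ∀ s, 0 ≤ lam s) (hμ : 0 < μ) (hθ : 0 ≤ θ)
    (hb : 0 ≤ b) (h0 : Integrable (fun ω => Real.exp (b * (Q 0 ω : ℝ))) P) (hβ : β < b)
    (hf : ∀ n, |f n| ≤ C * Real.exp (β * n)) :
    Continuous (fun s : ℝ => ∫ ω, f (Q s.toNNReal ω) ∂P) :=
  continuous_toNNReal_of_eq_add_integral
    (hQ.dynkin_of_exp_growth hlam hlam0 hμ hθ hb h0 hβ hf)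
    (hQ.intervalIntegrable_of_exp_growth hlam hlam0 hμ hθ hb h0 hβ hf)

/-- Kolmogorov's forward equation for functions of exponential growth. -/
lemma IsErlangA.hasDerivAt_integral_comp (hQ : IsErlangA P ℱ lam μ θ c Q)
    (hlam : Continuous lam) (hlam0 : ∀ s, 0 ≤ lam s) (hμ : 0 < μ) (hθ : 0 ≤ θ)
    (hb : 0 ≤ b) (h0 : Integrable (fun ω => Real.exp (b * (Q 0 ω : ℝ))) P) (hβ : β < b)
    (hf : ∀ n, |f n| ≤ C * Real.exp (β * n)) {t : ℝ} (ht : 0 < t) :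
    HasDerivAt (fun s : ℝ => ∫ ω, f (Q s.toNNReal ω) ∂P)
      (∫ ω, erlangAGenerator (lam t) μ θ c f (Q t.toNNReal ω) ∂P) t := by
  have hint : ∀ s : ℝ≥0, Integrable (fun ω => Real.exp (b * (Q s ω : ℝ))) P := fun s => by
    obtain ⟨B, hB⟩ := hQ.exists_exp_moment_bound hlam hlam0 hμ hθ hb h0 s
    exact (hB s le_rfl).1
  have hup : ∀ n : ℕ, |f (n + 1) - f n| ≤ (C * Real.exp β + C) * Real.exp (β * n) := fun n => by
    refine (abs_sub _ _).trans ((add_le_add (hf _) (hf _)).trans (le_of_eq ?_))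
    push_cast
    rw [mul_add, mul_one, Real.exp_add]; ring
  -- The departure term grows faster than e^{βn}, and continuity of its expectation again needs an
  -- exponent strictly below `b`; the midpoint leaves room for both losses.
  have hβ1 : β < (β + b) / 2 := by linarith
  have hβ2 : (β + b) / 2 < b := by linarith
  obtain ⟨K, hK⟩ := exists_generator_bound_of_exp_growth hμ hθ c (C := C) hβ1 0
  have hdown : ∀ n, |erlangADeparture μ θ c n * (f (n - 1) - f n)| ≤
      K * Real.exp ((β + b) / 2 * n) := fun n => by
    -- Arrival rate 0 isolates the departure part of the generator.
    simpa [erlangAGenerator] using hK f hf 0 le_rfl le_rfl n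
  have hG : Continuous
      (fun s => ∫ ω, erlangAGenerator (lam s) μ θ c f (Q s.toNNReal ω) ∂P) := by
    have heq : (fun s => ∫ ω, erlangAGenerator (lam s) μ θ c f (Q s.toNNReal ω) ∂P) = fun s =>
        lam s * (∫ ω, (fun n => f (n + 1) - f n) (Q s.toNNReal ω) ∂P) +
        ∫ ω, (fun n => erlangADeparture μ θ c n * (f (n - 1) - f n)) (Q s.toNNReal ω) ∂P := by
      funext s
      rw [← integral_const_mul, ← integral_add]
      · rfl
      · refine (hQ.integrable_comp (hint _) (f := fun n => f (n + 1) - f n)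
          (C := C * Real.exp β + C) fun n => (hup n).trans ?_).const_mul _
        have hC : 0 ≤ C := by simpa using (abs_nonneg _).trans (hf 0)
        gcongr
      · refine hQ.integrable_comp (hint _) (C := K)
          (f := fun n => erlangADeparture μ θ c n * (f (n - 1) - f n))
          fun n => (hdown n).trans ?_
        have hK0 : 0 ≤ K := by simpa using (abs_nonneg _).trans (hdown 0)
        gcongr
    rw [heq]
    exact (hlam.mul (hQ.continuous_integral_comp hlam hlam0 hμ hθ hb h0 hβ hup)).add
      (hQ.continuous_integral_comp hlam hlam0 hμ hθ hb h0 hβ2 hdown)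
  refine (((hG.integral_hasStrictDerivAt 0 t).hasDerivAt).const_add
    (∫ ω, f (Q 0 ω) ∂P)).congr_of_eventuallyEq ?_
  filter_upwards [lt_mem_nhds ht] with s hs
  rw [hQ.dynkin_of_exp_growth hlam hlam0 hμ hθ hb h0 hβ hf, Real.coe_toNNReal _ hs.le]

end Dynkin

/-! ### Maximum principle and the differential inequalities -/

section Comparison

/-- A function that is separately continuous, and monotone in the second variable, is continuous. -/
lemma continuousOn_prod_of_monotoneOn {M : ℝ → ℝ → ℝ} {S : Set ℝ} {l r : ℝ}
    (h₁ : ∀ α ∈ Icc l r, ContinuousOn (fun s => M s α) S)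
    (h₂ : ∀ s ∈ S, ContinuousOn (M s) (Icc l r)) (hm : ∀ s ∈ S, MonotoneOn (M s) (Icc l r)) :
    ContinuousOn (fun x : ℝ × ℝ => M x.1 x.2) (S ×ˢ Icc l r) := by
  rintro ⟨s₀, α₀⟩ ⟨hs₀, hα₀⟩
  simp only at hs₀ hα₀
  have hmem : ∀ᶠ x : ℝ × ℝ in 𝓝[S ×ˢ Icc l r] (s₀, α₀), x ∈ S ×ˢ Icc l r := self_mem_nhdsWithin
  have hfst : Tendsto Prod.fst (𝓝[S ×ˢ Icc l r] (s₀, α₀)) (𝓝[S] s₀) := by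
    rw [nhdsWithin_prod_eq]; exact tendsto_fst
  have hsnd : Tendsto Prod.snd (𝓝[S ×ˢ Icc l r] (s₀, α₀)) (𝓝[Icc l r] α₀) := by
    rw [nhdsWithin_prod_eq]; exact tendsto_snd
  refine tendsto_order.2 ⟨fun u hu => ?_, fun u hu => ?_⟩
  -- Monotonicity reduces the lower bound near α₀ to continuity in time at a single α₁ slightly left
  -- of α₀, or at α₀ itself if it is the left endpoint.
  · obtain ⟨α₁, hα₁, hu₁, hev⟩ : ∃ α₁ ∈ Icc l r, u < M s₀ α₁ ∧
        ∀ᶠ α in 𝓝[Icc l r] α₀, α₁ ≤ α := by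
      rcases hα₀.1.eq_or_lt with h | h
      · exact ⟨α₀, hα₀, hu, eventually_mem_nhdsWithin.mono fun α hα => h ▸ hα.1⟩
      · have hsub : Ioo l α₀ ⊆ Icc l r := fun x hx => ⟨hx.1.le, hx.2.le.trans hα₀.2⟩
        have : (𝓝[Ioo l α₀] α₀).NeBot := right_nhdsWithin_Ioo_neBot h
        obtain ⟨α₁, h1, h2⟩ := (((h₂ s₀ hs₀ α₀ hα₀).mono hsub).eventually_const_lt hu
          |>.and eventually_mem_nhdsWithin).exists
        exact ⟨α₁, hsub h2, h1, nhdsWithin_le_nhds ((lt_mem_nhds h2.2).mono fun _ h => le_of_lt h)⟩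
    filter_upwards [hmem, hsnd.eventually hev,
      hfst.eventually ((h₁ α₁ hα₁ s₀ hs₀).eventually_const_lt hu₁)] with x hx h1 h2
    exact h2.trans_le (hm _ hx.1 hα₁ hx.2 h1)
  · obtain ⟨α₁, hα₁, hu₁, hev⟩ : ∃ α₁ ∈ Icc l r, M s₀ α₁ < u ∧
        ∀ᶠ α in 𝓝[Icc l r] α₀, α ≤ α₁ := by
      rcases hα₀.2.eq_or_lt with h | h
      · exact ⟨α₀, hα₀, hu, eventually_mem_nhdsWithin.mono fun α hα => h ▸ hα.2⟩
      · have hsub : Ioo α₀ r ⊆ Icc l r := fun x hx => ⟨hα₀.1.trans hx.1.le, hx.2.le⟩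
        have : (𝓝[Ioo α₀ r] α₀).NeBot := left_nhdsWithin_Ioo_neBot h
        obtain ⟨α₁, h1, h2⟩ := (((h₂ s₀ hs₀ α₀ hα₀).mono hsub).eventually_lt_const hu
          |>.and eventually_mem_nhdsWithin).exists
        exact ⟨α₁, hsub h2, h1, nhdsWithin_le_nhds ((gt_mem_nhds h2.1).mono fun _ h => le_of_lt h)⟩
    filter_upwards [hmem, hsnd.eventually hev,
      hfst.eventually ((h₁ α₁ hα₁ s₀ hs₀).eventually_lt_const hu₁)] with x hx h1 h2
    exact (hm _ hx.1 hx.2 hα₁ h1).trans_lt h2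

/-- At a maximum relative to a convex set, derivatives towards points of the set are nonpositive. -/
lemma IsMaxOn.hasDerivWithinAt_mul_nonpos {f : ℝ → ℝ} {p x y : ℝ} {s : Set ℝ} (hs : Convex ℝ s)
    (hx : x ∈ s) (hy : y ∈ s) (hmax : IsMaxOn f s x) (hf : HasDerivWithinAt f p s x) :
    (y - x) * p ≤ 0 := by
  have h := hmax.localize.hasFDerivWithinAt_nonpos hf.hasFDerivWithinAt
    (sub_mem_posTangentConeAt_of_segment_subset (hs.segment_subset hx hy))
  simpa using h

/-- Maximum principle for first order differential inequalities on an interval with the endpoint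
`0`, with characteristics that point away from `0`. -/
lemma nonpos_of_outflow {D : ℝ → ℝ → ℝ} {T K a : ℝ}
    (hc : ContinuousOn (fun x : ℝ × ℝ => D x.1 x.2) (Icc 0 T ×ˢ uIcc 0 a))
    (h0 : ∀ α ∈ uIcc 0 a, D 0 α ≤ 0) (hb : ∀ t ∈ Icc 0 T, D t 0 ≤ 0)
    (hd : ∀ t ∈ Ioo 0 T, ∀ α ∈ uIcc 0 a, α ≠ 0 → ∃ p q, HasDerivWithinAt (D t) p (uIcc 0 a) α ∧
      HasDerivAt (fun s => D s α) q t ∧ (0 < D t α → 0 ≤ α * p → q ≤ K * D t α)) :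
    ∀ t ∈ Icc 0 T, ∀ α ∈ uIcc 0 a, D t α ≤ 0 := by
  -- The derivatives are given only before `T`; the final time is reached by continuity.
  have key : ∀ t ∈ Ico 0 T, ∀ α ∈ uIcc 0 a, D t α ≤ 0 := by
    intro t ht α hα
    by_contra! hpos
    -- Small enough that `W` is still positive at (t, α); the tilt -ε·time makes the inequality at
    -- the maximum strict.
    set ε := Real.exp (-(K * t)) * D t α / (2 * (t + 1)) with hε
    have hε0 : 0 < ε := by have := ht.1; positivity
    set W : ℝ × ℝ → ℝ := fun x => Real.exp (-(K * x.1)) * D x.1 x.2 - ε * x.1 with hW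
    have hsub : Icc 0 t ×ˢ uIcc 0 a ⊆ Icc 0 T ×ˢ uIcc 0 a :=
      prod_mono (Icc_subset_Icc_right ht.2.le) Subset.rfl
    have hWc : ContinuousOn W (Icc 0 t ×ˢ uIcc 0 a) :=
      ((by fun_prop : Continuous fun x : ℝ × ℝ => Real.exp (-(K * x.1))).continuousOn.mul
        (hc.mono hsub)).sub (by fun_prop)
    obtain ⟨⟨s, β⟩, ⟨hs, hβ⟩, hmax⟩ := (isCompact_Icc.prod isCompact_uIcc).exists_isMaxOn
      ⟨(t, α), ⟨right_mem_Icc.2 ht.1, hα⟩⟩ hWc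
    simp only at hs hβ
    have hWpos : 0 < W (s, β) := by
      refine lt_of_lt_of_le ?_
        (hmax (⟨right_mem_Icc.2 ht.1, hα⟩ : (t, α) ∈ Icc 0 t ×ˢ uIcc 0 a))
      simp only [hW]
      have h1 : ε * (2 * (t + 1)) = Real.exp (-(K * t)) * D t α := by
        rw [hε]; have := ht.1; field_simp
      have := ht.1
      nlinarith
    have hE : 0 < Real.exp (-(K * s)) := Real.exp_pos _
    have hDpos : 0 < D s β := by
      simp only [hW] at hWpos
      have : 0 ≤ ε * s := mul_nonneg hε0.le hs.1
      by_contra! h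
      nlinarith
    have hs0 : 0 < s := lt_of_le_of_ne hs.1 (by
      rintro rfl; exact absurd (h0 β hβ) (not_le.2 hDpos))
    have hβ0 : β ≠ 0 := by
      rintro rfl; exact absurd (hb s ⟨hs.1, hs.2.trans ht.2.le⟩) (not_le.2 hDpos)
    obtain ⟨p, q, hp, hq, hpq⟩ := hd s ⟨hs0, hs.2.trans_lt ht.2⟩ β hβ hβ0
    have hmaxα : IsMaxOn (D s) (uIcc 0 a) β := fun γ hγ => by
      have h := hmax (⟨hs, hγ⟩ : (s, γ) ∈ Icc 0 t ×ˢ uIcc 0 a)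
      simp only [hW, mem_ofPred_eq, sub_le_sub_iff_right] at h
      exact le_of_mul_le_mul_left h hE
    -- Only the direction towards 0 is tested, so β may be the far endpoint `a`.
    have hp' := hmaxα.hasDerivWithinAt_mul_nonpos (convex_uIcc _ _) hβ left_mem_uIcc hp
    have hq' := hpq hDpos (by linarith)
    have hmaxt : IsMaxOn (fun s => W (s, β)) (Icc 0 t) s := fun r hr =>
      hmax (⟨hr, hβ⟩ : (r, β) ∈ Icc 0 t ×ˢ uIcc 0 a)
    have hWd : HasDerivAt (fun s => W (s, β))
        (Real.exp (-(K * s)) * -(K * 1) * D s β + Real.exp (-(K * s)) * q - ε * 1) s :=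
      ((((hasDerivAt_id s).const_mul K).neg.exp).mul hq).sub ((hasDerivAt_id s).const_mul ε)
    -- Looking back in time, ∂ₜW ≥ 0 at the maximum, whereas q ≤ K·D forces ∂ₜW ≤ -ε.
    have ht' := hmaxt.hasDerivWithinAt_mul_nonpos (convex_Icc _ _) hs (left_mem_Icc.2 ht.1)
      hWd.hasDerivWithinAt
    nlinarith [mul_le_mul_of_nonneg_left hq' hE.le, mul_pos hs0 hε0,
      mul_le_mul_of_nonneg_left (mul_le_mul_of_nonneg_left hq' hE.le) hs0.le]
  intro t ht α hα
  rcases ht.2.lt_or_eq with h | rfl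
  · exact key t ⟨ht.1, h⟩ α hα
  rcases ht.1.eq_or_lt with h | h
  · rw [← h]; exact h0 α hα
  have hct : ContinuousWithinAt (fun s => D s α) (Ioo 0 t) t :=
    ContinuousWithinAt.comp (f := fun s : ℝ => (s, α)) (t := Icc 0 t ×ˢ uIcc 0 a)
      (hc (t, α) ⟨ht, hα⟩) (by fun_prop) fun s hs => ⟨⟨hs.1.le, hs.2.le⟩, hα⟩
  have : (𝓝[Ioo 0 t] t).NeBot := right_nhdsWithin_Ioo_neBot h
  exact le_of_tendsto hct (eventually_mem_nhdsWithin.mono fun s hs => key s ⟨hs.1.le, hs.2⟩ α hα)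

lemma mul_exp_neg_sub_one_nonpos {α p : ℝ} (h : 0 ≤ α * p) : (Real.exp (-α) - 1) * p ≤ 0 := by
  rcases lt_trichotomy α 0 with hα | rfl | hα
  · have : 1 ≤ Real.exp (-α) := Real.one_le_exp (by linarith)
    have : p ≤ 0 := by by_contra! hp; nlinarith
    nlinarith
  · simp
  · have : Real.exp (-α) ≤ 1 := Real.exp_le_one_iff.2 (by linarith)
    have : 0 ≤ p := by by_contra! hp; nlinarith
    nlinarith

/-- Write σ = e^{-α} - 1, so (θ-μ)σ ≥ 0. If p ≤ pf, the fluid minimum is the larger one and every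
term has the right sign. Otherwise the minima differ by at most p - pf, and the θ-terms cancel to
leave μσ(pf - p) ≤ 0. -/
lemma fluidRHS_sub_le {r μ θ α m p mf pf κ : ℝ} {c : ℕ} (hμ : 0 < μ) (hθ : 0 ≤ θ)
    (hκ : κ ≤ min p (c * m)) (hα : (θ - μ) * α ≤ 0) (hm : 0 < mf - m) (hp : 0 ≤ α * (pf - p)) :
    fluidRHS r μ θ c α mf pf - (r * (Real.exp α - 1) * m + θ * (Real.exp (-α) - 1) * p
      - (θ - μ) * (Real.exp (-α) - 1) * κ) ≤ r * (Real.exp α - 1) * (mf - m) := by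
  unfold fluidRHS
  have h1 : (Real.exp (-α) - 1) * (pf - p) ≤ 0 := mul_exp_neg_sub_one_nonpos hp
  have h2 : 0 ≤ (θ - μ) * (Real.exp (-α) - 1) := by
    have := mul_exp_neg_sub_one_nonpos (α := α) (p := -(θ - μ)) (by linarith)
    linarith
  set σ := Real.exp (-α) - 1
  have h3 := mul_le_mul_of_nonneg_left hκ h2
  have hcm : (c : ℝ) * m ≤ c * mf := by gcongr; linarith
  have h4 : θ * (σ * (pf - p)) + (θ - μ) * σ * (min p (c * m) - min pf (c * mf)) ≤ 0 := by
    rcases le_total p pf with hpp | hpp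
    · have h5 : min p (c * m) ≤ min pf (c * mf) := min_le_min hpp hcm
      have := mul_nonpos_of_nonneg_of_nonpos hθ h1
      have := mul_nonpos_of_nonneg_of_nonpos h2 (sub_nonpos.2 h5)
      linarith
    · have h5 : min p (c * m) - min pf (c * mf) ≤ p - pf := by
        rcases le_total pf (c * mf) with h | h
        · rw [min_eq_left h]; linarith [min_le_left p (c * m)]
        · rw [min_eq_right h]; linarith [min_le_right p (c * m)]
      have := mul_le_mul_of_nonneg_left h5 h2
      have := mul_nonpos_of_nonneg_of_nonpos hμ.le h1
      linarith
  linarith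

/-- The mirror case (θ-μ)σ ≤ 0. Here m > mf can also raise the minimum, by at most c(m - mf), which
accounts for the extra growth constant. -/
lemma sub_fluidRHS_le {r μ θ α m p mf pf κ : ℝ} {c : ℕ} (hμ : 0 < μ) (hθ : 0 ≤ θ)
    (hκ : κ ≤ min p (c * m)) (hα : 0 ≤ (θ - μ) * α) (hm : 0 < m - mf) (hp : 0 ≤ α * (p - pf)) :
    (r * (Real.exp α - 1) * m + θ * (Real.exp (-α) - 1) * p
      - (θ - μ) * (Real.exp (-α) - 1) * κ) - fluidRHS r μ θ c α mf pf ≤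
      (r * (Real.exp α - 1) + |θ - μ| * |Real.exp (-α) - 1| * c) * (m - mf) := by
  unfold fluidRHS
  have h1 : (Real.exp (-α) - 1) * (p - pf) ≤ 0 := mul_exp_neg_sub_one_nonpos hp
  have h2 : (θ - μ) * (Real.exp (-α) - 1) ≤ 0 := by
    have := mul_exp_neg_sub_one_nonpos (α := α) (p := θ - μ) (by linarith)
    linarith
  rw [← abs_mul, abs_of_nonpos h2]
  set σ := Real.exp (-α) - 1
  have h3 := mul_le_mul_of_nonneg_left hκ (neg_nonneg.2 h2)
  have hcm : 0 ≤ c * (m - mf) := by positivity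
  have h4 : θ * (σ * (p - pf)) + -((θ - μ) * σ) * (min p (c * m) - min pf (c * mf)) ≤
      -((θ - μ) * σ) * (c * (m - mf)) := by
    rcases le_total p pf with hpp | hpp
    · have h5 : min p (c * m) - min pf (c * mf) ≤ c * (m - mf) := by
        rcases le_total pf (c * mf) with h | h
        · rw [min_eq_left h]; linarith [min_le_left p (c * m)]
        · rw [min_eq_right h]; linarith [min_le_right p (c * m)]
      have := mul_nonpos_of_nonneg_of_nonpos hθ h1
      have := mul_le_mul_of_nonneg_left h5 (neg_nonneg.2 h2)
      linarith
    · have h5 : min p (c * m) - min pf (c * mf) ≤ (p - pf) + c * (m - mf) := by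
        rcases le_total pf (c * mf) with h | h
        · rw [min_eq_left h]; linarith [min_le_left p (c * m)]
        · rw [min_eq_right h]; linarith [min_le_right p (c * m)]
      have := mul_le_mul_of_nonneg_left h5 (neg_nonneg.2 h2)
      have := mul_nonpos_of_nonneg_of_nonpos hμ.le h1
      linarith
  linarith

end Comparison

/-! ### The evolution equation of the moment generating function -/

section MGF

lemma erlangAGenerator_exp (r μ θ : ℝ) (c : ℕ) (α : ℝ) (n : ℕ) :
    erlangAGenerator r μ θ c (fun m => Real.exp (α * m)) n =
      r * (Real.exp α - 1) * Real.exp (α * n) +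
      θ * (Real.exp (-α) - 1) * (n * Real.exp (α * n)) -
      (θ - μ) * (Real.exp (-α) - 1) * (min (n : ℝ) c * Real.exp (α * n)) := by
  unfold erlangAGenerator
  have h1 : Real.exp (α * (n + 1 : ℕ)) = Real.exp α * Real.exp (α * n) := by
    rw [← Real.exp_add]; push_cast; ring_nf
  simp only [h1]
  -- At n = 0 the truncated n - 1 is harmless because the departure rate is 0.
  rcases n with _ | n
  · simp [erlangADeparture]
  · have h2 : Real.exp (α * (n : ℕ)) = Real.exp (-α) * Real.exp (α * (n + 1 : ℕ)) := by
      rw [← Real.exp_add]; push_cast; ring_nf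
    simp only [Nat.add_sub_cancel, erlangADeparture_eq]
    rw [h2]
    ring

variable {Ω : Type*} [mΩ : MeasurableSpace Ω]
  {P : Measure Ω} [IsProbabilityMeasure P] {ℱ : Filtration ℝ≥0 mΩ} {lam : ℝ → ℝ}
  {μ θ : ℝ} {c : ℕ} {Q : ℝ≥0 → Ω → ℕ} {b : ℝ}

omit [IsProbabilityMeasure P] in
lemma IsErlangA.integrable_exp_of_le (hQ : IsErlangA P ℱ lam μ θ c Q) {t : ℝ≥0}
    (ht : Integrable (fun ω => Real.exp (b * (Q t ω : ℝ))) P) {α : ℝ} (hα : α ≤ b) :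
    Integrable (fun ω => Real.exp (α * (Q t ω : ℝ))) P := by
  refine hQ.integrable_comp (C := 1) ht (f := fun n => Real.exp (α * n)) fun n => ?_
  rw [abs_of_pos (Real.exp_pos _), one_mul]
  gcongr

lemma IsErlangA.integrable_exp (hQ : IsErlangA P ℱ lam μ θ c Q)
    (hlam : Continuous lam) (hlam0 : ∀ s, 0 ≤ lam s) (hμ : 0 < μ) (hθ : 0 ≤ θ)
    (hb : 0 ≤ b) (h0 : Integrable (fun ω => Real.exp (b * (Q 0 ω : ℝ))) P) (t : ℝ≥0) :
    Integrable (fun ω => Real.exp (b * (Q t ω : ℝ))) P := by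
  obtain ⟨B, hB⟩ := hQ.exists_exp_moment_bound hlam hlam0 hμ hθ hb h0 t
  exact (hB t le_rfl).1

omit [IsProbabilityMeasure P] in
lemma IsErlangA.continuousOn_mgf (hQ : IsErlangA P ℱ lam μ θ c Q) {t : ℝ≥0}
    (ht : Integrable (fun ω => Real.exp (b * (Q t ω : ℝ))) P) :
    ContinuousOn (mgf (fun ω => (Q t ω : ℝ)) P) (Iic b) := by
  refine continuousOn_of_dominated (bound := fun ω => Real.exp (b * (Q t ω : ℝ)))
    (fun α _ => ?_) (fun α hα => Eventually.of_forall fun ω => ?_) ht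
    (Eventually.of_forall fun ω => by fun_prop)
  · exact (hQ.measurable_comp (fun n => Real.exp (α * n)) t).aestronglyMeasurable
  · rw [Real.norm_of_nonneg (Real.exp_pos _).le]
    have : α ≤ b := hα
    gcongr

omit [IsProbabilityMeasure P] in
lemma IsErlangA.monotoneOn_mgf (hQ : IsErlangA P ℱ lam μ θ c Q) {t : ℝ≥0}
    (ht : Integrable (fun ω => Real.exp (b * (Q t ω : ℝ))) P) :
    MonotoneOn (mgf (fun ω => (Q t ω : ℝ)) P) (Iic b) := by
  intro α hα β hβ hαβ
  refine integral_mono (hQ.integrable_exp_of_le ht hα) (hQ.integrable_exp_of_le ht hβ) fun ω => ?_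
  simp only
  gcongr

omit [IsProbabilityMeasure P] in
lemma IsErlangA.hasDerivAt_mgf (hQ : IsErlangA P ℱ lam μ θ c Q) {t : ℝ≥0}
    (ht : Integrable (fun ω => Real.exp (b * (Q t ω : ℝ))) P) {α : ℝ} (hα : α < b) :
    HasDerivAt (mgf (fun ω => (Q t ω : ℝ)) P)
      (∫ ω, (Q t ω : ℝ) * Real.exp (α * (Q t ω : ℝ)) ∂P) α :=
  ProbabilityTheory.hasDerivAt_mgf (mem_interior.2 ⟨Iio b,
    fun _ hβ => hQ.integrable_exp_of_le ht (le_of_lt hβ), isOpen_Iio, hα⟩)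

lemma IsErlangA.continuous_mgf (hQ : IsErlangA P ℱ lam μ θ c Q)
    (hlam : Continuous lam) (hlam0 : ∀ s, 0 ≤ lam s) (hμ : 0 < μ) (hθ : 0 ≤ θ)
    (hb : 0 ≤ b) (h0 : Integrable (fun ω => Real.exp (b * (Q 0 ω : ℝ))) P) {α : ℝ} (hα : α < b) :
    Continuous (fun s : ℝ => mgf (fun ω => (Q s.toNNReal ω : ℝ)) P α) :=
  hQ.continuous_integral_comp hlam hlam0 hμ hθ hb h0 hα (C := 1)
    (f := fun n => Real.exp (α * n)) fun n => by rw [abs_of_pos (Real.exp_pos _), one_mul]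

/-- The evolution equation of the moment generating function. -/
lemma IsErlangA.hasDerivAt_mgf_time (hQ : IsErlangA P ℱ lam μ θ c Q)
    (hlam : Continuous lam) (hlam0 : ∀ s, 0 ≤ lam s) (hμ : 0 < μ) (hθ : 0 ≤ θ)
    (hb : 0 ≤ b) (h0 : Integrable (fun ω => Real.exp (b * (Q 0 ω : ℝ))) P) {α : ℝ} (hα : α < b)
    {t : ℝ} (ht : 0 < t) :
    ∃ κ ≤ min (∫ ω, (Q t.toNNReal ω : ℝ) * Real.exp (α * (Q t.toNNReal ω : ℝ)) ∂P)
        (c * mgf (fun ω => (Q t.toNNReal ω : ℝ)) P α),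
      HasDerivAt (fun s : ℝ => mgf (fun ω => (Q s.toNNReal ω : ℝ)) P α)
        (lam t * (Real.exp α - 1) * mgf (fun ω => (Q t.toNNReal ω : ℝ)) P α +
          θ * (Real.exp (-α) - 1) *
            (∫ ω, (Q t.toNNReal ω : ℝ) * Real.exp (α * (Q t.toNNReal ω : ℝ)) ∂P) -
          (θ - μ) * (Real.exp (-α) - 1) * κ) t := by
  have hi := hQ.integrable_exp hlam hlam0 hμ hθ hb h0 t.toNNReal
  have hm := hQ.integrable_exp_of_le hi hα.le
  have hp : Integrable (fun ω => (Q t.toNNReal ω : ℝ) * Real.exp (α * (Q t.toNNReal ω : ℝ))) P :=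
    hQ.integrable_comp hi (C := 1 / (b - α)) (f := fun n => n * Real.exp (α * n)) fun n => by
      rw [abs_of_nonneg (by positivity)]
      exact natCast_mul_exp_le hα n
  have hk : Integrable (fun ω => min (Q t.toNNReal ω : ℝ) c *
      Real.exp (α * (Q t.toNNReal ω : ℝ))) P := by
    refine hp.mono' (hQ.measurable_comp
      (fun n => min (n : ℝ) c * Real.exp (α * n)) _).aestronglyMeasurable
      (Eventually.of_forall fun ω => ?_)
    rw [Real.norm_of_nonneg (by positivity)]
    gcongr
    exact min_le_left _ _
  -- The exact term that the closure replaces; its bound by the minimum is the source of every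
  -- inequality in the theorem.
  refine ⟨∫ ω, min (Q t.toNNReal ω : ℝ) c * Real.exp (α * (Q t.toNNReal ω : ℝ)) ∂P,
    le_min (integral_mono hk hp fun ω => ?_) ?_, ?_⟩
  · gcongr
    exact min_le_left _ _
  · rw [mgf, ← integral_const_mul]
    refine integral_mono hk (hm.const_mul _) fun ω => ?_
    gcongr
    exact min_le_right _ _
  · have h := hQ.hasDerivAt_integral_comp hlam hlam0 hμ hθ hb h0 hα (C := 1)
      (f := fun n => Real.exp (α * n))
      (fun n => by rw [abs_of_pos (Real.exp_pos _), one_mul]) ht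
    refine HasDerivAt.congr_deriv h ?_
    simp only [erlangAGenerator_exp]
    refine (integral_sub ((hm.const_mul _).add (hp.const_mul _)) (hk.const_mul _)).trans ?_
    refine congr_arg₂ _ ((integral_add (hm.const_mul _) (hp.const_mul _)).trans ?_)
      (integral_const_mul _ _)
    exact congr_arg₂ _ (integral_const_mul _ _) (integral_const_mul _ _)

end MGF

/-! ### Comparison of the queue with its fluid closure -/

section FluidComparison

/-- At α = 0 both factors e^{±α} - 1 vanish, so the time derivative is 0. This is the boundary
condition of the maximum principle. -/
lemma IsFluidMGF.eq_initial_at_zero {lam : ℝ → ℝ} {μ θ : ℝ} {c : ℕ} {T : ℝ} {I : Set ℝ}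
    {M : ℝ → ℝ → ℝ} (hM : IsFluidMGF lam μ θ c T I M) (hI0 : (0 : ℝ) ∈ I) {t : ℝ}
    (ht : t ∈ Icc 0 T) : M t 0 = M 0 0 := by
  rcases ht.1.eq_or_lt with h | h
  · rw [← h]
  have hc : ContinuousOn (fun s => M s 0) (Icc 0 t) :=
    hM.continuousOn.comp (f := fun s : ℝ => (s, (0 : ℝ))) (by fun_prop)
      fun s hs => ⟨⟨hs.1, hs.2.trans ht.2⟩, hI0⟩
  obtain ⟨s, hs, hs'⟩ := exists_hasDerivAt_eq_slope (fun s => M s 0) (fun _ => 0) h hc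
    fun s hs => by
      obtain ⟨p, _, hp⟩ := hM.pde s ⟨hs.1, hs.2.trans_le ht.2⟩ 0 hI0
      simpa [fluidRHS] using hp
  have h1 : t - 0 ≠ 0 := by linarith
  rw [eq_comm, div_eq_zero_iff] at hs'
  rcases hs' with h2 | h2
  · linarith
  · exact absurd h2 h1

variable {Ω : Type*} [mΩ : MeasurableSpace Ω]
  {P : Measure Ω} [IsProbabilityMeasure P] {ℱ : Filtration ℝ≥0 mΩ} {lam : ℝ → ℝ}
  {μ θ : ℝ} {c : ℕ} {Q : ℝ≥0 → Ω → ℕ} {b : ℝ}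

/-- Monotonicity in α comes from Q ≥ 0. The point 0 is exempt from β < b because the transform is
identically 1 there; this permits b = 0. -/
lemma IsErlangA.continuousOn_mgf_prod (hQ : IsErlangA P ℱ lam μ θ c Q)
    (hlam : Continuous lam) (hlam0 : ∀ s, 0 ≤ lam s) (hμ : 0 < μ) (hθ : 0 ≤ θ)
    (hb : 0 ≤ b) (h0 : Integrable (fun ω => Real.exp (b * (Q 0 ω : ℝ))) P)
    {a : ℝ} (hab : ∀ β ∈ uIcc 0 a, β ≠ 0 → β < b) (S : Set ℝ) :
    ContinuousOn (fun x : ℝ × ℝ => mgf (fun ω => (Q x.1.toNNReal ω : ℝ)) P x.2)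
      (S ×ˢ uIcc 0 a) := by
  have hi := hQ.integrable_exp hlam hlam0 hμ hθ hb h0
  have hsub : uIcc 0 a ⊆ Iic b := fun β hβ => by
    by_cases h : β = 0
    · rw [h]; exact hb
    · exact (hab β hβ h).le
  refine continuousOn_prod_of_monotoneOn
    (M := fun s α => mgf (fun ω => (Q s.toNNReal ω : ℝ)) P α) (fun α hα => ?_)
    (fun s _ => (hQ.continuousOn_mgf (hi _)).mono hsub)
    (fun s _ => (hQ.monotoneOn_mgf (hi _)).mono hsub)
  by_cases h : α = 0
  · simp only [h, mgf_zero]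
    exact continuousOn_const
  · exact (hQ.continuous_mgf hlam hlam0 hμ hθ hb h0 (hab α hα h)).continuousOn

/-- Comparison of the moment generating function with the fluid one, below the abscissa of
integrability. -/
lemma IsErlangA.mgf_comparison (hQ : IsErlangA P ℱ lam μ θ c Q)
    (hlam : Continuous lam) (hlam0 : ∀ s, 0 ≤ lam s) (hμ : 0 < μ) (hθ : 0 ≤ θ)
    (hb : 0 ≤ b) (h0 : Integrable (fun ω => Real.exp (b * (Q 0 ω : ℝ))) P)
    {T : ℝ} {I : Set ℝ} (hI : I.OrdConnected) (hI0 : (0 : ℝ) ∈ I) {Mf : ℝ → ℝ → ℝ}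
    (hMf : IsFluidMGF lam μ θ c T I Mf)
    (hinit : ∀ α ∈ I, Mf 0 α = mgf (fun ω => (Q 0 ω : ℝ)) P α)
    {a : ℝ} (ha : a ∈ I) (hab : ∀ β ∈ uIcc 0 a, β ≠ 0 → β < b) {t : ℝ≥0} (ht : (t : ℝ) ≤ T) :
    ((θ - μ) * a ≤ 0 → Mf t a ≤ mgf (fun ω => (Q t ω : ℝ)) P a) ∧
    (0 ≤ (θ - μ) * a → mgf (fun ω => (Q t ω : ℝ)) P a ≤ Mf t a) := by
  have hJI : uIcc 0 a ⊆ I := hI.uIcc_subset hI0 ha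
  obtain ⟨R, hR⟩ := exists_uIcc_bound hlam 0 T
  have hMc := hQ.continuousOn_mgf_prod hlam hlam0 hμ hθ hb h0 hab (Icc 0 T)
  have hMfc : ContinuousOn (fun x : ℝ × ℝ => Mf x.1 x.2) (Icc 0 T ×ˢ uIcc 0 a) :=
    hMf.continuousOn.mono (prod_mono Subset.rfl hJI)
  have hMf0 : ∀ s ∈ Icc 0 T, Mf s 0 = mgf (fun ω => (Q s.toNNReal ω : ℝ)) P 0 := fun s hs => by
    rw [hMf.eq_initial_at_zero hI0 hs, hinit 0 hI0, mgf_zero, mgf_zero]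
  have htT : (t : ℝ) ∈ Icc 0 T := ⟨t.coe_nonneg, ht⟩
  -- Bounds the factors e^α - 1 and |e^{-α} - 1| over the whole interval, giving a constant growth
  -- rate `K`.
  set E := Real.exp |a| with hE
  have hE1 : 1 ≤ E := Real.one_le_exp (abs_nonneg a)
  have hrate : ∀ s ∈ Ioo 0 T, ∀ α ∈ uIcc 0 a, lam s * (Real.exp α - 1) ≤ R * E := by
    intro s hs α hα
    have h1 := hR s (Icc_subset_uIcc ⟨hs.1.le, hs.2.le⟩)
    have h2 : |α| ≤ |a| := by simpa using abs_sub_left_of_mem_uIcc hα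
    have h3 : Real.exp α ≤ E := Real.exp_le_exp.2 ((le_abs_self α).trans h2)
    calc lam s * (Real.exp α - 1) ≤ lam s * E :=
          mul_le_mul_of_nonneg_left (by linarith) (hlam0 s)
      _ ≤ R * E := by gcongr
  have hdown : ∀ α ∈ uIcc 0 a, |Real.exp (-α) - 1| ≤ E := by
    intro α hα
    have h2 : |α| ≤ |a| := by simpa using abs_sub_left_of_mem_uIcc hα
    have h3 : Real.exp (-α) ≤ E := Real.exp_le_exp.2 ((neg_le_abs α).trans h2)
    rw [abs_le]
    constructor <;> linarith [Real.exp_pos (-α)]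
  have hsign : ∀ {x : ℝ}, ∀ α ∈ uIcc 0 a, x * a ≤ 0 → x * α ≤ 0 := by
    intro x α hα hx
    rcases mem_uIcc.1 hα with h | h
    · rcases h.1.eq_or_lt with h' | h'
      · simp [← h']
      · have : x ≤ 0 := by by_contra! hx'; nlinarith
        nlinarith
    · rcases h.2.eq_or_lt with h' | h'
      · simp [h']
      · have : 0 ≤ x := by by_contra! hx'; nlinarith
        nlinarith
  constructor
  · intro hsgn
    have := nonpos_of_outflow (T := T) (K := R * E) (a := a)
      (D := fun s α => Mf s α - mgf (fun ω => (Q s.toNNReal ω : ℝ)) P α)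
      (hMfc.sub hMc) (fun α hα => by simp [hinit α (hJI hα)])
      (fun s hs => by rw [hMf0 s hs, sub_self]) (fun s hs α hα hα0 => ?_) t htT a right_mem_uIcc
    · simpa using this
    · obtain ⟨pf, hpf, hqf⟩ := hMf.pde s hs α (hJI hα)
      obtain ⟨κ, hκ, hq⟩ := hQ.hasDerivAt_mgf_time hlam hlam0 hμ hθ hb h0 (hab α hα hα0) hs.1
      have hp := hQ.hasDerivAt_mgf (hQ.integrable_exp hlam hlam0 hμ hθ hb h0 s.toNNReal)
        (hab α hα hα0)
      refine ⟨_, _, (hpf.mono hJI).sub hp.hasDerivWithinAt, hqf.sub hq, fun hpos hαp => ?_⟩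
      refine (fluidRHS_sub_le hμ hθ hκ (hsign α hα hsgn) hpos hαp).trans ?_
      exact mul_le_mul_of_nonneg_right (hrate s hs α hα) hpos.le
  · intro hsgn
    have := nonpos_of_outflow (T := T) (K := R * E + |θ - μ| * E * c) (a := a)
      (D := fun s α => mgf (fun ω => (Q s.toNNReal ω : ℝ)) P α - Mf s α)
      (hMc.sub hMfc) (fun α hα => by simp [hinit α (hJI hα)])
      (fun s hs => by rw [hMf0 s hs, sub_self]) (fun s hs α hα hα0 => ?_) t htT a right_mem_uIcc
    · simpa using this
    · obtain ⟨pf, hpf, hqf⟩ := hMf.pde s hs α (hJI hα)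
      obtain ⟨κ, hκ, hq⟩ := hQ.hasDerivAt_mgf_time hlam hlam0 hμ hθ hb h0 (hab α hα hα0) hs.1
      have hp := hQ.hasDerivAt_mgf (hQ.integrable_exp hlam hlam0 hμ hθ hb h0 s.toNNReal)
        (hab α hα hα0)
      refine ⟨_, _, hp.hasDerivWithinAt.sub (hpf.mono hJI), hq.sub hqf, fun hpos hαp => ?_⟩
      have hsgn' : 0 ≤ (θ - μ) * α := by
        have := hsign (x := -(θ - μ)) α hα (by linarith)
        linarith
      refine (sub_fluidRHS_le hμ hθ hκ hsgn' hpos hαp).trans ?_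
      refine mul_le_mul_of_nonneg_right (add_le_add (hrate s hs α hα) ?_) hpos.le
      gcongr
      exact hdown α hα

/-- For α ≤ 0 take b = 0: nonzero points of [α,0] lie strictly below it. For α > 0 only b = α is
available, and E[Qe^{αQ}] may be infinite, so compare at a < α and let a increase to α. -/
lemma IsErlangA.mgf_comparison_of_mem (hQ : IsErlangA P ℱ lam μ θ c Q)
    (hlam : Continuous lam) (hlam0 : ∀ s, 0 ≤ lam s) (hμ : 0 < μ) (hθ : 0 ≤ θ)
    {T : ℝ} {I : Set ℝ} (hI : I.OrdConnected) (hI0 : (0 : ℝ) ∈ I)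
    (hexp : ∀ α ∈ I, Integrable (fun ω => Real.exp (α * (Q 0 ω : ℝ))) P) {Mf : ℝ → ℝ → ℝ}
    (hMf : IsFluidMGF lam μ θ c T I Mf)
    (hinit : ∀ α ∈ I, Mf 0 α = mgf (fun ω => (Q 0 ω : ℝ)) P α)
    {α : ℝ} (hα : α ∈ I) {t : ℝ≥0} (ht : (t : ℝ) ≤ T) :
    ((θ - μ) * α ≤ 0 → Mf t α ≤ mgf (fun ω => (Q t ω : ℝ)) P α) ∧
    (0 ≤ (θ - μ) * α → mgf (fun ω => (Q t ω : ℝ)) P α ≤ Mf t α) := by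
  rcases le_or_gt α 0 with hα0 | hα0
  · refine hQ.mgf_comparison hlam hlam0 hμ hθ le_rfl (hexp 0 hI0) hI hI0 hMf hinit hα
      (fun β hβ hβ0 => ?_) ht
    rw [uIcc_of_ge hα0] at hβ
    exact lt_of_le_of_ne hβ.2 hβ0
  have hsub : Ioo 0 α ⊆ I := fun x hx => hI.out hI0 hα ⟨hx.1.le, hx.2.le⟩
  have hcomp := fun a (haα : a ∈ Ioo 0 α) =>
    hQ.mgf_comparison hlam hlam0 hμ hθ hα0.le (hexp α hα) hI hI0 hMf hinit (hsub haα)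
      (fun β hβ _ => by
        rw [uIcc_of_le haα.1.le] at hβ
        exact hβ.2.trans_lt haα.2) ht
  have : (𝓝[Ioo 0 α] α).NeBot := right_nhdsWithin_Ioo_neBot hα0
  have hlimf : Tendsto (fun a => Mf t a) (𝓝[Ioo 0 α] α) (𝓝 (Mf t α)) :=
    ContinuousWithinAt.comp (f := fun a : ℝ => ((t : ℝ), a)) (t := Icc 0 T ×ˢ I)
      (hMf.continuousOn (t, α) ⟨⟨t.coe_nonneg, ht⟩, hα⟩) (by fun_prop)
      fun a ha => ⟨⟨t.coe_nonneg, ht⟩, hsub ha⟩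
  have hlim : Tendsto (mgf (fun ω => (Q t ω : ℝ)) P) (𝓝[Ioo 0 α] α)
      (𝓝 (mgf (fun ω => (Q t ω : ℝ)) P α)) :=
    (hQ.continuousOn_mgf (hQ.integrable_exp hlam hlam0 hμ hθ hα0.le (hexp α hα) t) α
      (mem_Iic.2 le_rfl)).mono fun a ha => le_of_lt ha.2
  refine ⟨fun h => ?_, fun h => ?_⟩
  · refine le_of_tendsto_of_tendsto hlimf hlim (eventually_mem_nhdsWithin.mono fun a ha => ?_)
    refine (hcomp a ha).1 (mul_nonpos_of_nonpos_of_nonneg ?_ ha.1.le)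
    by_contra! h'
    nlinarith
  · refine le_of_tendsto_of_tendsto hlim hlimf (eventually_mem_nhdsWithin.mono fun a ha => ?_)
    refine (hcomp a ha).2 (mul_nonneg ?_ ha.1.le)
    by_contra! h'
    nlinarith

omit [IsProbabilityMeasure P] in
/-- Only the values of the arrival rate at nonnegative times matter. -/
lemma IsErlangA.congr_lam (hQ : IsErlangA P ℱ lam μ θ c Q) {lam' : ℝ → ℝ}
    (h : ∀ s, 0 ≤ s → lam s = lam' s) : IsErlangA P ℱ lam' μ θ c Q where
  adapted := hQ.adapted
  right_continuous := hQ.right_continuous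
  left_limits := hQ.left_limits
  martingale f hf := by
    convert hQ.martingale f hf using 4 with t ω
    refine intervalIntegral.integral_congr fun s hs => ?_
    rw [uIcc_of_le t.coe_nonneg] at hs
    simp only [h s hs.1]

lemma IsFluidMGF.congr_lam {T : ℝ} {I : Set ℝ} {M : ℝ → ℝ → ℝ}
    (hM : IsFluidMGF lam μ θ c T I M) {lam' : ℝ → ℝ} (h : ∀ s, 0 ≤ s → lam s = lam' s) :
    IsFluidMGF lam' μ θ c T I M where
  continuousOn := hM.continuousOn
  pde t ht α hα := by
    obtain ⟨p, h1, h2⟩ := hM.pde t ht α hα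
    exact ⟨p, h1, h t ht.1.le ▸ h2⟩

end FluidComparison

theorem theorem3 {Ω : Type*} [mΩ : MeasurableSpace Ω] (P : Measure Ω) [IsProbabilityMeasure P]
    (ℱ : Filtration ℝ≥0 mΩ)
    (lam : ℝ → ℝ) (hlam_cont : ContinuousOn lam (Ici 0)) (hlam_nonneg : ∀ t, 0 ≤ t → 0 ≤ lam t)
    (μ θ : ℝ) (hμ : 0 < μ) (hθ : 0 ≤ θ) (c : ℕ) (hc : 0 < c)
    (Q : ℝ≥0 → Ω → ℕ) (hQ : IsErlangA P ℱ lam μ θ c Q)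
    (T : ℝ) (I : Set ℝ) (hI : I.OrdConnected) (hI0 : (0 : ℝ) ∈ I)
    (hexp : ∀ α ∈ I, Integrable (fun ω => Real.exp (α * (Q 0 ω : ℝ))) P)
    (Mf : ℝ → ℝ → ℝ) (hMf : IsFluidMGF lam μ θ c T I Mf)
    (hinit : ∀ α ∈ I, Mf 0 α = mgf (fun ω => (Q 0 ω : ℝ)) P α) :
    (∀ t : ℝ≥0, (t : ℝ) ≤ T → ∀ α ∈ I,
      Integrable (fun ω => Real.exp (α * (Q t ω : ℝ))) P) ∧
    (θ < μ → ∀ t : ℝ≥0, (t : ℝ) ≤ T → ∀ α ∈ I,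
      (0 ≤ α → Mf t α ≤ mgf (fun ω => (Q t ω : ℝ)) P α) ∧
      (α ≤ 0 → mgf (fun ω => (Q t ω : ℝ)) P α ≤ Mf t α)) ∧
    (μ < θ → ∀ t : ℝ≥0, (t : ℝ) ≤ T → ∀ α ∈ I,
      (0 ≤ α → mgf (fun ω => (Q t ω : ℝ)) P α ≤ Mf t α) ∧
      (α ≤ 0 → Mf t α ≤ mgf (fun ω => (Q t ω : ℝ)) P α)) ∧
    (θ = μ → ∀ t : ℝ≥0, (t : ℝ) ≤ T → ∀ α ∈ I,
      mgf (fun ω => (Q t ω : ℝ)) P α = Mf t α) := by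
  -- Extend the rate to negative times by its value at 0, making it continuous and nonnegative on
  -- all of ℝ.
  have hlam' : ∀ s, 0 ≤ s → lam s = lam (max s 0) := fun s hs => by rw [max_eq_left hs]
  have hc' : Continuous fun s => lam (max s 0) :=
    hlam_cont.comp_continuous (by fun_prop) fun s => mem_Ici.2 (le_max_right _ _)
  have h0' : ∀ s, 0 ≤ lam (max s 0) := fun s => hlam_nonneg _ (le_max_right _ _)
  have hQ' := hQ.congr_lam hlam'
  have hcomp : ∀ t : ℝ≥0, (t : ℝ) ≤ T → ∀ α ∈ I, _ := fun t ht α hα =>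
    hQ'.mgf_comparison_of_mem hc' h0' hμ hθ hI hI0 hexp (hMf.congr_lam hlam') hinit hα ht
  refine ⟨fun t _ α hα => ?_, fun h t ht α hα => ⟨fun hα0 => ?_, fun hα0 => ?_⟩,
    fun h t ht α hα => ⟨fun hα0 => ?_, fun hα0 => ?_⟩, fun h t ht α hα => le_antisymm ?_ ?_⟩
  -- Moments propagate for nonnegative exponents; a negative α is dominated by exponent 0.
  · have hmax : max α 0 ∈ I := by rcases max_choice α 0 with h | h <;> rw [h] <;> assumption
    exact hQ'.integrable_exp_of_le (hQ'.integrable_exp hc' h0' hμ hθ (le_max_right _ _)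
      (hexp _ hmax) t) (le_max_left _ _)
  · exact (hcomp t ht α hα).1 (mul_nonpos_of_nonpos_of_nonneg (by linarith) hα0)
  · exact (hcomp t ht α hα).2 (mul_nonneg_of_nonpos_of_nonpos (by linarith) hα0)
  · exact (hcomp t ht α hα).2 (mul_nonneg (by linarith) hα0)
  · exact (hcomp t ht α hα).1 (mul_nonpos_of_nonneg_of_nonpos (by linarith) hα0)
  · exact (hcomp t ht α hα).2 (by simp [h])
  · exact (hcomp t ht α hα).1 (by simp [h])
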